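/- Let $A\in\mathbb R^{n\times n}$, $B\in\mathbb R^{n\times m}$, $C\in\mathbb R^{p\times n}$, $S\in\mathbb R^{q\times q}$ be such that $(A,B)$ is stabilizable, $(A,C)$ is observable, $S$ has no eigenvalue with negative real part, and $$\operatorname{rank}\begin{bmatrix}A-\lambda I_n & B\\ C & 0\end{bmatrix}=n+p\quad\text{for every (complex) eigenvalue }\lambda\text{ of }S .$$ Let $\beta\in\mathbb R^{d\times d}$ have as characteristic polynomial the minimal polynomial of $S$, let $\sigma\in\mathbb R^{d}$ be such that $(\beta,\sigma)$ is controllable, and put $G_1=\mathrm{blockdiag}(\beta,\dots,\beta)$, $G_2=\mathrm{blockdiag}(\sigma,\dots,\sigma)$ ($p$ blocks each), $n_z=pd$, and $$Y=\begin{bmatrix}A&0\\ G_2C&G_1\end{bmatrix},\quad J=\begin{bmatrix}B\\0\end{bmatrix},\quad \bar C=\begin{bmatrix}C&0\\0&I_{n_z}\end{bmatrix}.$$ Let $L\in\mathbb R^{n\times p}$ be such that $A-LC$ is Hurwitz (all eigenvalues have negative real part). Write $\det(sI_n-A+LC)=s^n+\alpha_{n-1}s^{n-1}+\dots+\alpha_0$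 and $(sI_n-A+LC)^{-1}=\dfrac{D_{n-1}s^{n-1}+\dots+D_1s+D_0}{\det(sI_n-A+LC)}$. Let $\mathcal A\in\mathbb R^{n\times n}$ be the companion matrix with ones on the superdiagonal, last row $(-\alpha_0,\dots,-\alpha_{n-1})$ and zeros elsewhere, let $b=(0,\dots,0,1)^T\in\mathbb R^n$, and let $M=[M_1,\dots,M_{m+p}]$, $M_i=[D_0f_i,\dots,D_{n-1}f_i]$, where $f_1,\dots,f_{m+p}$ are the columns of $[B\;\;L]$. Put $$B_\zeta=\begin{bmatrix}I_m\otimes b\\0\end{bmatrix},\quad E_\zeta=\begin{bmatrix}0\\I_p\otimes b\end{bmatrix},\quad A_\zeta=I_{m+p}\otimes\mathcal A+E_\zeta CM,$$ $$A_\rho=\begin{bmatrix}A_\zeta&0\\G_2CM&G_1\end{bmatrix},\quad B_\rho=\begin{bmatrix}B_\zeta\\0\end{bmatrix},\quad W=\mathrm{blockdiag}(M,I_{n_z}).$$ Let $R\in\mathbb R^{m\times m}$ and $\bar Q\in\mathbb R^{(p+n_z)\times(p+n_z)}$ be symmetric positive definite, and let $Q_\xi=\bar C^T\bar Q\bar C$,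 $Q_\rho=W^TQ_\xi W$. Then: 1. The Riccati equation $Y^TP+PY+Q_\xi-PJR^{-1}J^TP=0$ has a unique positive definite solution $P_\xi^*$. 2. The Riccati equation $A_\rho^TP+PA_\rho+Q_\rho-PB_\rho R^{-1}B_\rho^TP=0$ has a unique positive semidefinite solution $P_\rho^*$, and $P_\rho^*=W^TP_\xi^*W$. 3. With $K_\xi^*=-R^{-1}J^TP_\xi^*$ and $K_\rho^*=-R^{-1}B_\rho^TP_\rho^*$ one has $K_\rho^*=-R^{-1}B_\rho^TW^TP_\xi^*W=K_\xi^*W$. 4. The feedback $u=K_\rho^*\rho$ is the solution of the LQR problem of minimizing $\int_0^\infty(\rho^TQ_\rho\rho+u^TRu)\,dt$ subject to $\dot\rho=A_\rho\rho+B_\rho u$: for every initial state $\rho(0)$, the cost of this feedback is finite and minimal among all locally integrable inputs $u$ on $[0,\infty)$, and every input of minimal cost satisfies $u(t)=K_\rho^*\rho(t)$ for almost every $t\ge 0$. -/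

import Mathlib

open Matrix MeasureTheory
open scoped Kronecker ENNReal

noncomputable section

namespace OutputRegulation

/-! ### Linear systems -/

/-- The real matrix `A` with its entries regarded as complex numbers. -/
def toC {ι κ : Type*} (A : Matrix ι κ ℝ) : Matrix ι κ ℂ := A.map (fun a : ℝ => (a : ℂ))

/-- `A` is Hurwitz: all its complex eigenvalues have negative real part. -/
def IsHurwitz {ι : Type*} [Fintype ι] [DecidableEq ι] (A : Matrix ι ι ℝ) : Prop :=
  ∀ μ ∈ spectrum ℂ (toC A), μ.re < 0

/-- `(A, B)` is stabilizable: `A + B K` is Hurwitz for some feedback gain `K`. -/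
def IsStabilizable {ι κ : Type*} [Fintype ι] [DecidableEq ι] [Fintype κ]
    (A : Matrix ι ι ℝ) (B : Matrix ι κ ℝ) : Prop :=
  ∃ K : Matrix κ ι ℝ, IsHurwitz (A + B * K)

/-- `(A, B)` is controllable: `[B, A B, …, A ^ (n - 1) B]` has rank `n`. -/
def IsControllable {n : ℕ} {κ : Type*} [Fintype κ]
    (A : Matrix (Fin n) (Fin n) ℝ) (B : Matrix (Fin n) κ ℝ) : Prop :=
  (Matrix.of fun (i : Fin n) (kj : Fin n × κ) => (A ^ (kj.1 : ℕ) * B) i kj.2).rank = n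

/-- `(A, C)` is observable: `col (C, C A, …, C A ^ (n - 1))` has rank `n`. -/
def IsObservable {n : ℕ} {κ : Type*}
    (A : Matrix (Fin n) (Fin n) ℝ) (C : Matrix κ (Fin n) ℝ) : Prop :=
  (Matrix.of fun (kj : Fin n × κ) (i : Fin n) => (C * A ^ (kj.1 : ℕ)) kj.2 i).rank = n

/-- `P` solves the algebraic Riccati equation `Aᵀ P + P A + Q - P B R⁻¹ Bᵀ P = 0`. -/
def SolvesRiccati {ι κ : Type*} [Fintype ι] [Fintype κ] [DecidableEq κ]
    (A : Matrix ι ι ℝ) (B : Matrix ι κ ℝ) (Q : Matrix ι ι ℝ) (R : Matrix κ κ ℝ)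
    (P : Matrix ι ι ℝ) : Prop :=
  Aᵀ * P + P * A + Q - P * B * R⁻¹ * Bᵀ * P = 0

/-- The feedback gain `-R⁻¹ Bᵀ P`. -/
def gain {ι κ : Type*} [Fintype ι] [Fintype κ] [DecidableEq κ]
    (B : Matrix ι κ ℝ) (R : Matrix κ κ ℝ) (P : Matrix ι ι ℝ) : Matrix κ ι ℝ :=
  -(R⁻¹ * Bᵀ * P)

/-! ### The linear quadratic regulator problem -/

/-- On `[0, ∞)`, `x` is the (Carathéodory) solution of `ẋ = A x + B u`, `x 0 = x₀`, for the locally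
integrable input `u`. -/
structure IsTrajectory {ι κ : Type*} [Fintype ι] [Fintype κ]
    (A : Matrix ι ι ℝ) (B : Matrix ι κ ℝ) (x₀ : ι → ℝ)
    (x : ℝ → ι → ℝ) (u : ℝ → κ → ℝ) : Prop where
  input_integrable : ∀ t : ℝ, 0 ≤ t → IntervalIntegrable u volume 0 t
  continuousOn : ContinuousOn x (Set.Ici 0)
  integral_eq : ∀ t : ℝ, 0 ≤ t → x t = x₀ + ∫ s in (0 : ℝ)..t, (A *ᵥ x s + B *ᵥ u s)

/-- The quadratic cost `∫₀^∞ (xᵀ Q x + uᵀ R u) dt`, possibly infinite (used for `Q, R ≥ 0`). -/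
def cost {ι κ : Type*} [Fintype ι] [Fintype κ] (Q : Matrix ι ι ℝ) (R : Matrix κ κ ℝ)
    (x : ℝ → ι → ℝ) (u : ℝ → κ → ℝ) : ℝ≥0∞ :=
  ∫⁻ t in Set.Ioi (0 : ℝ), ENNReal.ofReal (x t ⬝ᵥ (Q *ᵥ x t) + u t ⬝ᵥ (R *ᵥ u t))

/-- The feedback `u = K x` is the solution of the problem of minimizing `cost Q R x u` subject to
`ẋ = A x + B u`: from every initial state the closed loop has a trajectory, its cost is finite and
minimal among all inputs, and an input of minimal cost is given by `u = K x` almost everywhere. -/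
def IsLQRSolution {ι κ : Type*} [Fintype ι] [Fintype κ]
    (A : Matrix ι ι ℝ) (B : Matrix ι κ ℝ) (Q : Matrix ι ι ℝ) (R : Matrix κ κ ℝ)
    (K : Matrix κ ι ℝ) : Prop :=
  ∀ x₀ : ι → ℝ, ∃ x : ℝ → ι → ℝ,
    IsTrajectory A B x₀ x (fun t => K *ᵥ x t) ∧
    cost Q R x (fun t => K *ᵥ x t) < ∞ ∧
    ∀ (x' : ℝ → ι → ℝ) (u' : ℝ → κ → ℝ), IsTrajectory A B x₀ x' u' →
      cost Q R x (fun t => K *ᵥ x t) ≤ cost Q R x' u' ∧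
      (cost Q R x' u' = cost Q R x (fun t => K *ᵥ x t) →
        ∀ᵐ t ∂(volume.restrict (Set.Ioi (0 : ℝ))), u' t = K *ᵥ x' t)

/-! ### The internal model and the augmented system -/

section Internal

variable {n m p d : ℕ}

/-- `G₁ = blockdiag (β, …, β)` with `p` blocks. -/
def G1 (p : ℕ) (β : Matrix (Fin d) (Fin d) ℝ) : Matrix (Fin p × Fin d) (Fin p × Fin d) ℝ :=
  (1 : Matrix (Fin p) (Fin p) ℝ) ⊗ₖ β

/-- `G₂ = blockdiag (σ, …, σ)` with `p` blocks. -/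
def G2 (p : ℕ) (σ : Fin d → ℝ) : Matrix (Fin p × Fin d) (Fin p) ℝ :=
  Matrix.of fun ik j => if ik.1 = j then σ ik.2 else 0

/-- The state matrix `Y = [A, 0; G₂ C, G₁]` of the augmented system. -/
def augY (A : Matrix (Fin n) (Fin n) ℝ) (C : Matrix (Fin p) (Fin n) ℝ)
    (β : Matrix (Fin d) (Fin d) ℝ) (σ : Fin d → ℝ) :
    Matrix (Fin n ⊕ Fin p × Fin d) (Fin n ⊕ Fin p × Fin d) ℝ :=
  Matrix.fromBlocks A 0 (G2 p σ * C) (G1 p β)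

/-- The input matrix `J = [B; 0]` of the augmented system. -/
def augJ (p d : ℕ) (B : Matrix (Fin n) (Fin m) ℝ) :
    Matrix (Fin n ⊕ Fin p × Fin d) (Fin m) ℝ :=
  Matrix.fromRows B 0

/-- `C̄ = blockdiag (C, I)`. -/
def barC (d : ℕ) (C : Matrix (Fin p) (Fin n) ℝ) :
    Matrix (Fin p ⊕ Fin p × Fin d) (Fin n ⊕ Fin p × Fin d) ℝ :=
  Matrix.fromBlocks C 0 0 1

end Internal

/-! ### The augmented auxiliary system -/

section Auxiliary

variable {n m p d : ℕ}

/-- The companion matrix with ones on the superdiagonal and last row `-α₀, …, -α_{n-1}`, where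
`sⁿ + α_{n-1} sⁿ⁻¹ + ⋯ + α₀` is the characteristic polynomial of `F`. -/
def companionA (F : Matrix (Fin n) (Fin n) ℝ) : Matrix (Fin n) (Fin n) ℝ :=
  Matrix.of fun i j =>
    if (i : ℕ) + 1 = n then -F.charpoly.coeff (j : ℕ)
    else if (j : ℕ) = (i : ℕ) + 1 then 1 else 0

/-- `b = col (0, …, 0, 1)`. -/
def lastVec (n : ℕ) : Fin n → ℝ := fun i => if (i : ℕ) + 1 = n then 1 else 0

/-- The coefficient matrix `D_k` in `adj (s I - F) = ∑ D_k s ^ k`, that is, in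
`(s I - F)⁻¹ = (∑ D_k s ^ k) / det (s I - F)`. -/
def resolventCoeff (F : Matrix (Fin n) (Fin n) ℝ) (k : ℕ) : Matrix (Fin n) (Fin n) ℝ :=
  Matrix.of fun i j => (F.charmatrix.adjugate i j).coeff k

/-- `M = [M_1, …, M_{m+p}]` with `M_w = [D_0 f_w, …, D_{n-1} f_w]`, where `f_w` runs through the
columns of `[B, L]` and `F = A - L C`. -/
def matM (A : Matrix (Fin n) (Fin n) ℝ) (B : Matrix (Fin n) (Fin m) ℝ)
    (C : Matrix (Fin p) (Fin n) ℝ) (L : Matrix (Fin n) (Fin p) ℝ) :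
    Matrix (Fin n) ((Fin m ⊕ Fin p) × Fin n) ℝ :=
  Matrix.of fun i wj => (resolventCoeff (A - L * C) (wj.2 : ℕ) * Matrix.fromCols B L) i wj.1

/-- `B_ζ = [I_m ⊗ b; 0]`. -/
def Bzeta (n m p : ℕ) : Matrix ((Fin m ⊕ Fin p) × Fin n) (Fin m) ℝ :=
  Matrix.of fun wi j => if wi.1 = Sum.inl j then lastVec n wi.2 else 0

/-- `E_ζ = [0; I_p ⊗ b]`. -/
def Ezeta (n m p : ℕ) : Matrix ((Fin m ⊕ Fin p) × Fin n) (Fin p) ℝ :=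
  Matrix.of fun wi j => if wi.1 = Sum.inr j then lastVec n wi.2 else 0

/-- `A_ζ = I_{m+p} ⊗ 𝒜 + E_ζ C M`. -/
def Azeta (A : Matrix (Fin n) (Fin n) ℝ) (B : Matrix (Fin n) (Fin m) ℝ)
    (C : Matrix (Fin p) (Fin n) ℝ) (L : Matrix (Fin n) (Fin p) ℝ) :
    Matrix ((Fin m ⊕ Fin p) × Fin n) ((Fin m ⊕ Fin p) × Fin n) ℝ :=
  (1 : Matrix (Fin m ⊕ Fin p) (Fin m ⊕ Fin p) ℝ) ⊗ₖ companionA (A - L * C)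
    + Ezeta n m p * C * matM A B C L

/-- `A_ρ = [A_ζ, 0; G₂ C M, G₁]`. -/
def Arho (A : Matrix (Fin n) (Fin n) ℝ) (B : Matrix (Fin n) (Fin m) ℝ)
    (C : Matrix (Fin p) (Fin n) ℝ) (L : Matrix (Fin n) (Fin p) ℝ)
    (β : Matrix (Fin d) (Fin d) ℝ) (σ : Fin d → ℝ) :
    Matrix ((Fin m ⊕ Fin p) × Fin n ⊕ Fin p × Fin d)
      ((Fin m ⊕ Fin p) × Fin n ⊕ Fin p × Fin d) ℝ :=
  Matrix.fromBlocks (Azeta A B C L) 0 (G2 p σ * C * matM A B C L) (G1 p β)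

/-- `B_ρ = [B_ζ; 0]`. -/
def Brho (n m p d : ℕ) : Matrix ((Fin m ⊕ Fin p) × Fin n ⊕ Fin p × Fin d) (Fin m) ℝ :=
  Matrix.fromRows (Bzeta n m p) 0

/-- `W = blockdiag (M, I)`. -/
def matW (d : ℕ) (A : Matrix (Fin n) (Fin n) ℝ) (B : Matrix (Fin n) (Fin m) ℝ)
    (C : Matrix (Fin p) (Fin n) ℝ) (L : Matrix (Fin n) (Fin p) ℝ) :
    Matrix (Fin n ⊕ Fin p × Fin d) ((Fin m ⊕ Fin p) × Fin n ⊕ Fin p × Fin d) ℝ :=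
  Matrix.fromBlocks (matM A B C L) 0 0 1

end Auxiliary

end OutputRegulation

end

open OutputRegulation

/-! The heart of the matter is the intertwining $WA_\rho=YW$, $WB_\rho=J$ (`matW_mul_Arho`,
`matW_mul_Brho`). It comes from the recursion $FD_j=D_{j-1}-\alpha_jI$ for $F=A-LC$, which gives
$M(I\otimes\mathcal A)=FM$, and from $D_{n-1}=I$. Multiplying the Riccati equation of $(Y,J)$ by
$W^T$ and $W$ turns a solution $P$ into the solution $W^TPW$ of the equation of $(A_\rho,B_\rho)$,
and the gains match. So existence is only needed for $(Y,J)$, and uniqueness for both systems.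

Uniqueness among semidefinite solutions needs detectability alone (`riccati_unique`). Output
injection shows it: $Y$ becomes $\mathrm{diag}(A-LC,-I)$ and $A_\rho$ becomes
$\mathrm{diag}(I\otimes\mathcal A,-I)$, both Hurwitz.

Existence needs stabilizability of $(Y,J)$ as well. The Hautus test `augY_hautus` combines the rank
condition on the spectrum of $S$ with controllability of $(\beta,\sigma)$. Then `exists_riccati`
minimizes the trace over a compact set of matrices with nonpositive Riccati residual; a Newton step
from the minimizer cannot lower the trace, which makes the residual zero. Definiteness follows from
observability of $(A,C)$, since $\ker P$ is $Y$-invariant and lies in $\ker\bar C$.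

For optimality, completing the square gives, up to time $T$, cost
$=x_0^TPx_0-x(T)^TPx(T)+\int|u-Kx|_R^2$. Detectability makes the terminal term small at arbitrarily
late times whenever the cost is finite (`IsTrajectory.exists_small`), so convergence of the state is
never needed. -/

namespace OutputRegulation

open Matrix Filter Topology
open scoped ComplexOrder

/-! ### Stable matrices and Lyapunov equations. -/

section Stability

variable {ι κ : Type*} [Fintype ι] [DecidableEq ι] [Fintype κ]

/-- All eigenvalues of the complex matrix `A` have negative real part. -/
def IsStable (A : Matrix ι ι ℂ) : Prop := ∀ μ ∈ spectrum ℂ A, μ.re < 0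

theorem mem_spectrum_iff_exists_mulVec {A : Matrix ι ι ℂ} {μ : ℂ} :
    μ ∈ spectrum ℂ A ↔ ∃ v ≠ 0, A *ᵥ v = μ • v := by
  rw [spectrum.mem_iff, Matrix.isUnit_iff_isUnit_det, isUnit_iff_ne_zero, not_not,
    ← Matrix.exists_mulVec_eq_zero_iff]
  simp only [sub_mulVec, sub_eq_zero, Algebra.algebraMap_eq_smul_one, smul_mulVec, one_mulVec]
  exact exists_congr fun v => and_congr_right fun _ => eq_comm

theorem mem_spectrum_iff_exists_vecMul {A : Matrix ι ι ℂ} {μ : ℂ} :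
    μ ∈ spectrum ℂ A ↔ ∃ v ≠ 0, v ᵥ* A = μ • v := by
  rw [spectrum.mem_iff, Matrix.isUnit_iff_isUnit_det, isUnit_iff_ne_zero, not_not,
    ← Matrix.exists_vecMul_eq_zero_iff]
  simp only [vecMul_sub, sub_eq_zero, Algebra.algebraMap_eq_smul_one, vecMul_smul, vecMul_one]
  exact exists_congr fun v => and_congr_right fun _ => eq_comm

theorem IsStable.eq_zero_of_mulVec {A : Matrix ι ι ℂ} (hA : IsStable A) {μ : ℂ} (hμ : 0 ≤ μ.re)
    {v : ι → ℂ} (hv : A *ᵥ v = μ • v) : v = 0 := by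
  by_contra h
  exact (hA μ (mem_spectrum_iff_exists_mulVec.2 ⟨v, h, hv⟩)).not_ge hμ

theorem IsStable.eq_zero_of_vecMul {A : Matrix ι ι ℂ} (hA : IsStable A) {μ : ℂ} (hμ : 0 ≤ μ.re)
    {v : ι → ℂ} (hv : v ᵥ* A = μ • v) : v = 0 := by
  by_contra h
  exact (hA μ (mem_spectrum_iff_exists_vecMul.2 ⟨v, h, hv⟩)).not_ge hμ

theorem isStable_of_mulVec {A : Matrix ι ι ℂ}
    (h : ∀ (μ : ℂ) (v : ι → ℂ), 0 ≤ μ.re → A *ᵥ v = μ • v → v = 0) : IsStable A := by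
  intro μ hμ
  obtain ⟨v, hv, hv'⟩ := mem_spectrum_iff_exists_mulVec.1 hμ
  by_contra hre
  exact hv (h μ v (not_lt.1 hre) hv')

section Powers

open scoped Matrix.Norms.Operator ENNReal NNReal

/-- Gelfand's formula: $\|N^k\|^{1/k}$ is eventually below some $r<1$, so the powers decay like
$r^k$. -/
theorem tendsto_pow_zero_of_spectrum {N : Matrix ι ι ℂ} (hN : ∀ μ ∈ spectrum ℂ N, ‖μ‖ < 1) :
    Tendsto (fun k : ℕ => N ^ k) atTop (𝓝 0) := by
  rcases isEmpty_or_nonempty ι with hι | hι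
  · exact tendsto_const_nhds.congr fun k => Subsingleton.elim _ _
  have h1 : spectralRadius ℂ N < (1 : ℝ≥0) :=
    spectrum.spectralRadius_lt_of_forall_lt N fun k hk => by
      rw [← NNReal.coe_lt_coe]; simpa using hN k hk
  obtain ⟨r, hr0, hr1⟩ := exists_between h1
  have hrt : r ≠ ∞ := (hr1.trans_le le_top).ne
  have h2 := (spectrum.pow_nnnorm_pow_one_div_tendsto_nhds_spectralRadius N).eventually
    (gt_mem_nhds hr0)
  have h3 : Tendsto (fun k : ℕ => r ^ k) atTop (𝓝 0) :=
    ENNReal.tendsto_pow_atTop_nhds_zero_of_lt_one (by simpa using hr1)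
  have h4 : Tendsto (fun k : ℕ => (‖N ^ k‖₊ : ℝ≥0∞)) atTop (𝓝 0) := by
    refine tendsto_of_tendsto_of_tendsto_of_le_of_le' tendsto_const_nhds h3
      (Eventually.of_forall fun _ => zero_le) ?_
    filter_upwards [h2, eventually_gt_atTop 0] with k hk hk0
    have hk0' : (k : ℝ) ≠ 0 := by positivity
    calc (‖N ^ k‖₊ : ℝ≥0∞) = ((‖N ^ k‖₊ : ℝ≥0∞) ^ (1 / k : ℝ)) ^ (k : ℝ) := by
          rw [← ENNReal.rpow_mul, one_div_mul_cancel hk0', ENNReal.rpow_one]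
      _ ≤ r ^ (k : ℝ) := ENNReal.rpow_le_rpow hk.le (by positivity)
      _ = r ^ k := ENNReal.rpow_natCast _ _
  have h5 := (ENNReal.tendsto_toReal ENNReal.zero_ne_top).comp h4
  exact tendsto_zero_iff_norm_tendsto_zero.2 (by simpa [Function.comp_def] using h5)

end Powers

theorem isUnit_sub_one_of_isStable {A : Matrix ι ι ℂ} (hA : IsStable A) :
    IsUnit (A - 1) := by
  have h : (1 : ℂ) ∉ spectrum ℂ A := fun h => absurd (hA 1 h) (by simp)
  rw [spectrum.notMem_iff] at h
  simpa using h.neg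

/-- The Cayley transform of a stable matrix is power convergent to `0`. -/
theorem tendsto_cayley_pow {A : Matrix ι ι ℂ} (hA : IsStable A) :
    Tendsto (fun k : ℕ => ((A + 1) * (A - 1)⁻¹) ^ k) atTop (𝓝 0) := by
  have hu : IsUnit (A - 1).det := (isUnit_iff_isUnit_det _).1 (isUnit_sub_one_of_isStable hA)
  refine tendsto_pow_zero_of_spectrum fun μ hμ => ?_
  obtain ⟨v, hv, hv'⟩ := mem_spectrum_iff_exists_mulVec.1 hμ
  -- The Cayley transform is its own inverse: $w$ is an eigenvector of $A$ for $(\mu+1)/(\mu-1)$,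
  -- whose real part is $(|\mu|^2-1)/|\mu-1|^2$.
  obtain ⟨w, rfl⟩ : ∃ w, v = (A - 1) *ᵥ w :=
    ⟨(A - 1)⁻¹ *ᵥ v, by rw [mulVec_mulVec, mul_nonsing_inv _ hu, one_mulVec]⟩
  have hw : w ≠ 0 := by rintro rfl; simp at hv
  rw [mulVec_mulVec, Matrix.mul_assoc, nonsing_inv_mul _ hu, Matrix.mul_one, add_mulVec,
    sub_mulVec, one_mulVec, smul_sub] at hv'
  have h1 : (μ - 1) • (A *ᵥ w) = (μ + 1) • w := by
    rw [sub_smul, add_smul, one_smul, one_smul, ← sub_eq_zero]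
    rw [← sub_eq_zero] at hv'
    rw [← neg_eq_zero, ← hv']; abel
  have hμ1 : μ - 1 ≠ 0 := by
    intro h
    rw [h, zero_smul, sub_eq_zero.1 h] at h1
    exact hw ((smul_eq_zero.1 h1.symm).resolve_left (by norm_num))
  have h2 : A *ᵥ w = ((μ + 1) / (μ - 1)) • w := by
    rw [div_eq_inv_mul, ← smul_smul, ← h1, smul_smul, inv_mul_cancel₀ hμ1, one_smul]
  have h3 := hA _ (mem_spectrum_iff_exists_mulVec.2 ⟨w, hw, h2⟩)
  have h4 : 0 < Complex.normSq (μ - 1) := Complex.normSq_pos.2 hμ1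
  rw [Complex.div_re, ← add_div, div_neg_iff] at h3
  rcases h3 with h3 | h3
  · exact absurd h3.2 h4.not_gt
  · have h5 : ‖μ‖ ^ 2 < 1 := by
      rw [Complex.sq_norm, Complex.normSq_apply]
      have := h3.1
      simp at this
      nlinarith
    nlinarith [norm_nonneg μ]

/-- Lyapunov's inequality has only positive semidefinite solutions when `A` is stable. -/
theorem posSemidef_of_lyapunov {A X : Matrix ι ι ℂ} (hA : IsStable A) (hX : X.IsHermitian)
    (h : (-(Aᴴ * X + X * A)).PosSemidef) : X.PosSemidef := by
  have hu : IsUnit (A - 1).det := (isUnit_iff_isUnit_det _).1 (isUnit_sub_one_of_isStable hA)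
  set T := (A - 1)⁻¹ with hT
  set N := (A + 1) * T with hN
  have hid : (A - 1) * T = 1 := mul_nonsing_inv _ hu
  -- The Cayley transform turns Lyapunov's inequality into the discrete one $X\ge N^HXN$; iterating
  -- gives $X\ge (N^k)^HXN^k\to0$.
  have hstep : (X - Nᴴ * X * N).PosSemidef := by
    have h1 : X - Nᴴ * X * N = Tᴴ * ((2 : ℂ) • -(Aᴴ * X + X * A)) * T := by
      have h2 : (2 : ℂ) • -(Aᴴ * X + X * A) = (A - 1)ᴴ * X * (A - 1) - (A + 1)ᴴ * X * (A + 1) := by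
        rw [two_smul, conjTranspose_sub, conjTranspose_add, conjTranspose_one]
        noncomm_ring
      have h3 : Tᴴ * ((A - 1)ᴴ * X * (A - 1) - (A + 1)ᴴ * X * (A + 1)) * T
          = ((A - 1) * T)ᴴ * X * ((A - 1) * T) - Nᴴ * X * N := by
        rw [hN, conjTranspose_mul, conjTranspose_mul]
        noncomm_ring
      rw [h2, h3, hid, conjTranspose_one, Matrix.one_mul, Matrix.mul_one]
    rw [h1]
    exact (h.smul (by norm_num)).conjTranspose_mul_mul_same T
  have hk : ∀ k : ℕ, (X - (N ^ k)ᴴ * X * N ^ k).PosSemidef := by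
    intro k
    induction k with
    | zero => simpa using PosSemidef.zero
    | succ k ih =>
      have : X - (N ^ (k + 1))ᴴ * X * N ^ (k + 1)
          = (X - Nᴴ * X * N) + Nᴴ * (X - (N ^ k)ᴴ * X * N ^ k) * N := by
        rw [pow_succ, conjTranspose_mul]
        noncomm_ring
      rw [this]
      exact hstep.add (ih.conjTranspose_mul_mul_same N)
  refine PosSemidef.of_dotProduct_mulVec_nonneg hX fun v => ?_
  have hlim : Tendsto (fun k : ℕ => star v ⬝ᵥ ((X - (N ^ k)ᴴ * X * N ^ k) *ᵥ v)) atTop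
      (𝓝 (star v ⬝ᵥ ((X - (0 : Matrix ι ι ℂ)ᴴ * X * 0) *ᵥ v))) := by
    have hc : Continuous fun Z : Matrix ι ι ℂ => star v ⬝ᵥ ((X - Zᴴ * X * Z) *ᵥ v) := by fun_prop
    exact (hc.tendsto 0).comp (tendsto_cayley_pow hA)
  have := ge_of_tendsto' hlim fun k => (hk k).dotProduct_mulVec_nonneg v
  simpa using this

theorem eq_zero_of_posSemidef_of_neg {ι : Type*} [Fintype ι] {X : Matrix ι ι ℂ} (h : X.PosSemidef)
    (h' : (-X).PosSemidef) : X = 0 := by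
  refine (PosSemidef.trace_eq_zero_iff h).1 (le_antisymm ?_ h.trace_nonneg)
  simpa using h'.trace_nonneg

/-- A Hermitian solution is semidefinite together with its negative. A general one is reduced to the
Hermitian solutions $X+X^H$ and $i(X-X^H)$. -/
theorem eq_zero_of_lyapunov {A X : Matrix ι ι ℂ} (hA : IsStable A)
    (h : Aᴴ * X + X * A = 0) : X = 0 := by
  have key : ∀ Y : Matrix ι ι ℂ, Y.IsHermitian → Aᴴ * Y + Y * A = 0 → Y = 0 := by
    intro Y hY hY0
    refine eq_zero_of_posSemidef_of_neg (posSemidef_of_lyapunov hA hY ?_)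
      (posSemidef_of_lyapunov hA hY.neg ?_)
    · rw [hY0, neg_zero]; exact .zero
    · have : Aᴴ * -Y + -Y * A = -(Aᴴ * Y + Y * A) := by noncomm_ring
      rw [this, hY0]; simpa using PosSemidef.zero
  have hs : Aᴴ * Xᴴ + Xᴴ * A = 0 := by
    have := congrArg conjTranspose h
    simpa [conjTranspose_add, conjTranspose_mul, add_comm] using this
  have h1 := key (X + Xᴴ) (by simp [IsHermitian, add_comm]) (by
    rw [Matrix.mul_add, Matrix.add_mul, add_add_add_comm, h, hs, add_zero])
  have h2 := key (Complex.I • (X - Xᴴ)) (by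
    simp only [IsHermitian, conjTranspose_smul, conjTranspose_sub, conjTranspose_conjTranspose,
      Complex.star_def, Complex.conj_I, neg_smul, ← smul_neg, neg_sub]) (by
    rw [Matrix.mul_smul, Matrix.smul_mul, ← smul_add, Matrix.mul_sub, Matrix.sub_mul,
      sub_add_sub_comm, h, hs, sub_zero, smul_zero])
  have h3 : X - Xᴴ = 0 := (smul_eq_zero.1 h2).resolve_left Complex.I_ne_zero
  have h4 : (2 : ℂ) • X = 0 := by
    rw [two_smul]; nth_rewrite 2 [sub_eq_zero.1 h3]; exact h1
  exact (smul_eq_zero.1 h4).resolve_left two_ne_zero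

/-- Lyapunov's equation is solvable when `A` is stable. -/
theorem exists_lyapunov {A Q : Matrix ι ι ℂ} (hA : IsStable A) (hQ : Q.PosSemidef) :
    ∃ X : Matrix ι ι ℂ, X.PosSemidef ∧ Aᴴ * X + X * A + Q = 0 := by
  let T : Matrix ι ι ℂ →ₗ[ℂ] Matrix ι ι ℂ :=
    LinearMap.mulLeft ℂ Aᴴ + LinearMap.mulRight ℂ A
  have hT : ∀ X, T X = Aᴴ * X + X * A := fun X => rfl
  have hinj : Function.Injective T := by
    rw [← LinearMap.ker_eq_bot, LinearMap.ker_eq_bot']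
    exact fun X hX => eq_zero_of_lyapunov hA hX
  obtain ⟨X, hX⟩ := LinearMap.injective_iff_surjective.1 hinj (-Q)
  rw [hT] at hX
  have hh : X.IsHermitian := by
    have h1 : Aᴴ * (Xᴴ - X) + (Xᴴ - X) * A = 0 := by
      have := congrArg conjTranspose hX
      simp only [conjTranspose_add, conjTranspose_mul, conjTranspose_conjTranspose,
        conjTranspose_neg, hQ.isHermitian.eq] at this
      rw [← hX] at this
      rw [Matrix.mul_sub, Matrix.sub_mul, sub_add_sub_comm, add_comm (Aᴴ * Xᴴ), this, sub_self]
    exact sub_eq_zero.1 (eq_zero_of_lyapunov hA h1)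
  refine ⟨X, posSemidef_of_lyapunov hA hh ?_, by rw [hX, neg_add_cancel]⟩
  rw [hX, neg_neg]; exact hQ

end Stability

end OutputRegulation

namespace OutputRegulation

open Matrix Filter Topology
open scoped ComplexOrder

/-! ### Pole shifting and the Hautus test for stabilizability. -/

section PoleShifting

open Polynomial

variable {ι κ : Type*} [Fintype ι] [DecidableEq ι] [Fintype κ] [DecidableEq κ]

/-- A rank one perturbation along a left eigenvector moves only the corresponding eigenvalue. -/
theorem charpoly_add_vecMulVec {A : Matrix ι ι ℂ} {w : ι → ℂ} {μ : ℂ} (hw : w ᵥ* A = μ • w)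
    (b : ι → ℂ) :
    (X - C μ) * (A + vecMulVec b w).charpoly = (X - C (μ + w ⬝ᵥ b)) * A.charpoly := by
  refine Polynomial.funext fun s => ?_
  simp only [eval_mul, eval_sub, eval_X, eval_C, eval_charpoly]
  have hvm : w ᵥ* (scalar ι s - A) = (s - μ) • w := by
    rw [vecMul_sub, hw, sub_smul]
    congr 1
    ext i
    simp [scalar_apply, vecMul_diagonal, mul_comm]
  -- At $s=\mu$ both sides vanish, the right one because $w$ is a left null vector of $\mu I-A$.
  -- Elsewhere the matrix determinant lemma applies.
  rcases eq_or_ne s μ with rfl | hs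
  · rw [sub_self, zero_mul]
    rcases eq_or_ne w 0 with rfl | hw0
    · simp
    · rw [sub_self, zero_smul] at hvm
      rw [exists_vecMul_eq_zero_iff.1 ⟨w, hw0, hvm⟩, mul_zero]
  · have hs' : s - μ ≠ 0 := sub_ne_zero.2 hs
    have hfac : scalar ι s - (A + vecMulVec b w)
        = (1 + replicateCol Unit b * replicateRow Unit (-((s - μ)⁻¹ • w))) * (scalar ι s - A) := by
      rw [Matrix.add_mul, Matrix.one_mul, Matrix.mul_assoc, ← replicateRow_vecMul, neg_vecMul,
        smul_vecMul, hvm, smul_smul, inv_mul_cancel₀ hs', one_smul, sub_add_eq_sub_sub,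
        sub_eq_add_neg _ (vecMulVec b w)]
      congr 1
      ext i j
      simp [vecMulVec_apply, Matrix.mul_apply]
    rw [hfac, det_mul, det_one_add_replicateCol_mul_replicateRow, ← mul_assoc]
    congr 1
    rw [neg_dotProduct, smul_dotProduct, smul_eq_mul]
    field_simp
    ring

/-- The Popov–Belevitch–Hautus test for stabilizability. -/
theorem exists_isStable_add_mul {A : Matrix ι ι ℂ} {B : Matrix ι κ ℂ}
    (h : ∀ (μ : ℂ) (w : ι → ℂ), 0 ≤ μ.re → w ᵥ* A = μ • w → w ᵥ* B = 0 → w = 0) :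
    ∃ K : Matrix κ ι ℂ, IsStable (A + B * K) := by
  classical
  -- Induction on the number of eigenvalues in the closed right half plane, with multiplicity: each
  -- feedback moves one of them to $-1$ and preserves the hypothesis.
  induction hn : A.charpoly.roots.countP (fun μ => 0 ≤ μ.re) using Nat.strong_induction_on
    generalizing A with
  | _ n ih =>
  by_cases hA : IsStable A
  · exact ⟨0, by simpa using hA⟩
  simp only [IsStable, not_forall, not_lt] at hA
  obtain ⟨μ, hμ, hre⟩ := hA
  obtain ⟨w, hw0, hw⟩ := mem_spectrum_iff_exists_vecMul.1 hμ
  have hwB : w ᵥ* B ≠ 0 := fun hB => hw0 (h μ w hre hw hB)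
  obtain ⟨j, hj⟩ := Function.ne_iff.1 hwB
  rw [Pi.zero_apply] at hj
  -- Chosen so that $w\cdot b=-1-\mu$, which sends the eigenvalue $\mu$ to $-1$.
  set c : ℂ := (-1 - μ) / (w ᵥ* B) j with hc
  set b : ι → ℂ := B *ᵥ Pi.single j c with hb
  have hwb : w ⬝ᵥ b = -1 - μ := by
    rw [hb, dotProduct_mulVec, dotProduct_single, hc, mul_div_cancel₀ _ hj]
  have hBK : B * vecMulVec (Pi.single j c) w = vecMulVec b w := by
    rw [mul_vecMulVec]
  have hchar := charpoly_add_vecMulVec hw b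
  rw [hwb] at hchar
  have hroots := congrArg Polynomial.roots hchar
  rw [roots_mul (mul_ne_zero (X_sub_C_ne_zero _) (charpoly_monic _).ne_zero),
    roots_mul (mul_ne_zero (X_sub_C_ne_zero _) (charpoly_monic _).ne_zero), roots_X_sub_C,
    roots_X_sub_C] at hroots
  have hcount := congrArg (Multiset.countP (fun μ : ℂ => 0 ≤ μ.re)) hroots
  rw [Multiset.countP_add, Multiset.countP_add, hn, ← Multiset.cons_zero, ← Multiset.cons_zero,
    Multiset.countP_cons_of_pos (p := fun μ : ℂ => 0 ≤ μ.re) _ hre,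
    Multiset.countP_cons_of_neg (p := fun μ : ℂ => 0 ≤ μ.re) _ (by norm_num)] at hcount
  simp only [Multiset.countP_zero, zero_add] at hcount
  obtain ⟨K, hK⟩ := ih ((A + vecMulVec b w).charpoly.roots.countP (fun μ => 0 ≤ μ.re)) (by omega)
    (A := A + B * vecMulVec (Pi.single j c) w)
    (fun ν v hν hv hvB => h ν v hν (by
      rwa [vecMul_add, ← vecMul_vecMul, hvB, zero_vecMul, add_zero] at hv) hvB)
    (by rw [hBK])
  exact ⟨vecMulVec (Pi.single j c) w + K, by rwa [Matrix.mul_add, ← add_assoc]⟩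

end PoleShifting

/-! ### Uniqueness and existence for the complex Riccati equation. -/

section Riccati

variable {ι κ : Type*} [Fintype ι] [Fintype κ] [DecidableEq κ]

/-- The left-hand side of the algebraic Riccati equation over `ℂ`. -/
noncomputable def riccati (A : Matrix ι ι ℂ) (B : Matrix ι κ ℂ) (Q : Matrix ι ι ℂ) (R : Matrix κ κ ℂ)
    (P : Matrix ι ι ℂ) : Matrix ι ι ℂ :=
  Aᴴ * P + P * A + Q - P * B * R⁻¹ * Bᴴ * P

/-- The feedback gain `-R⁻¹ Bᴴ P`. -/
noncomputable def cgain (B : Matrix ι κ ℂ) (R : Matrix κ κ ℂ) (P : Matrix ι ι ℂ) : Matrix κ ι ℂ :=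
  -(R⁻¹ * Bᴴ * P)

variable {A : Matrix ι ι ℂ} {B : Matrix ι κ ℂ} {Q P : Matrix ι ι ℂ} {R : Matrix κ κ ℂ}

/-- Completion of the square in $K$. At $K$ equal to the gain of $P$, the Lyapunov and Riccati
residuals coincide; all comparisons of solutions below rest on this. -/
theorem lyapunov_eq_riccati_add (hR : R.PosDef) (hP : P.IsHermitian) (K : Matrix κ ι ℂ) :
    (A + B * K)ᴴ * P + P * (A + B * K) + (Q + Kᴴ * R * K)
      = riccati A B Q R P + (K - cgain B R P)ᴴ * R * (K - cgain B R P) := by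
  have hu : IsUnit R.det := (isUnit_iff_isUnit_det _).1 hR.isUnit
  set G := cgain B R P with hG
  have h1 : Bᴴ * P = -(R * G) := by
    rw [hG, cgain, Matrix.mul_neg, neg_neg, Matrix.mul_assoc, mul_nonsing_inv_cancel_left _ _ hu]
  have h2 : P * B = -(Gᴴ * R) := by
    have := congrArg conjTranspose h1
    rwa [conjTranspose_mul, conjTranspose_conjTranspose, hP.eq, conjTranspose_neg,
      conjTranspose_mul, hR.isHermitian.eq] at this
  have h3 : P * B * R⁻¹ * Bᴴ * P = Gᴴ * R * G := by
    rw [h2, Matrix.neg_mul, Matrix.mul_assoc Gᴴ, mul_nonsing_inv _ hu, Matrix.mul_one,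
      Matrix.mul_assoc, h1, Matrix.neg_mul, Matrix.mul_neg, neg_neg, Matrix.mul_assoc]
  have h4 : (B * K)ᴴ * P = -(Kᴴ * R * G) := by
    rw [conjTranspose_mul, Matrix.mul_assoc, h1, Matrix.mul_neg, Matrix.mul_assoc]
  have h5 : P * (B * K) = -(Gᴴ * R * K) := by rw [← Matrix.mul_assoc, h2, Matrix.neg_mul]
  rw [riccati, h3, conjTranspose_add, conjTranspose_sub, Matrix.add_mul, Matrix.mul_add, h4, h5]
  simp only [Matrix.sub_mul, Matrix.mul_sub]
  abel

/-- `(A, Q)` has no unobservable mode in the closed right half plane. -/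
def IsDetectable (A Q : Matrix ι ι ℂ) : Prop :=
  ∀ (μ : ℂ) (v : ι → ℂ), 0 ≤ μ.re → A *ᵥ v = μ • v → Q *ᵥ v = 0 → v = 0

variable [DecidableEq ι]

/-- A nonpositive residual suffices, and the minimization in `exists_riccati` needs that generality.
For an eigenvector $v$ with $\mathrm{Re}\,\mu\ge0$, four nonnegative terms add up to zero, so $Qv=0$
and $Kv=0$, and $v$ is an undetectable mode of $A$. -/
theorem isStable_of_riccati (hR : R.PosDef) (hQ : Q.PosSemidef) (hdet : IsDetectable A Q)
    (hP : P.PosSemidef) (hric : (-riccati A B Q R P).PosSemidef) :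
    IsStable (A + B * cgain B R P) := by
  refine isStable_of_mulVec fun μ v hμ hv => ?_
  set K := cgain B R P with hK
  have hid := lyapunov_eq_riccati_add (A := A) (B := B) (Q := Q) hR hP.isHermitian K
  rw [← hK, sub_self, Matrix.mul_zero, add_zero] at hid
  have h0 : star v ⬝ᵥ (((A + B * K)ᴴ * P + P * (A + B * K) + (Q + Kᴴ * R * K)
      + -riccati A B Q R P) *ᵥ v) = 0 := by
    rw [hid, add_neg_cancel, zero_mulVec, dotProduct_zero]
  have h1 : star v ⬝ᵥ (((A + B * K)ᴴ * P) *ᵥ v) = star μ * (star v ⬝ᵥ (P *ᵥ v)) := by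
    rw [← mulVec_mulVec, dotProduct_mulVec, ← star_mulVec, hv, star_smul, smul_dotProduct,
      smul_eq_mul]
  have h2 : star v ⬝ᵥ ((P * (A + B * K)) *ᵥ v) = μ * (star v ⬝ᵥ (P *ᵥ v)) := by
    rw [← mulVec_mulVec, hv, mulVec_smul, dotProduct_smul, smul_eq_mul]
  rw [add_mulVec, add_mulVec, add_mulVec, dotProduct_add, dotProduct_add, dotProduct_add, h1, h2,
    add_mulVec, dotProduct_add, ← add_mul] at h0
  have hKRK : (Kᴴ * R * K).PosSemidef := hR.posSemidef.conjTranspose_mul_mul_same K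
  have hμ' : 0 ≤ star μ + μ := by
    rw [add_comm, Complex.star_def, Complex.add_conj]
    exact_mod_cast (by positivity : (0 : ℝ) ≤ 2 * μ.re)
  have n1 := mul_nonneg hμ' (hP.dotProduct_mulVec_nonneg v)
  have n2 := hQ.dotProduct_mulVec_nonneg v
  have n3 := hKRK.dotProduct_mulVec_nonneg v
  have n4 := hric.dotProduct_mulVec_nonneg v
  have e4 := (add_eq_zero_iff_of_nonneg (add_nonneg n1 (add_nonneg n2 n3)) n4).1 h0
  have e3 := (add_eq_zero_iff_of_nonneg n1 (add_nonneg n2 n3)).1 e4.1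
  have e2 := (add_eq_zero_iff_of_nonneg n2 n3).1 e3.2
  have hQv : Q *ᵥ v = 0 := (hQ.dotProduct_mulVec_zero_iff v).1 e2.1
  have hKv : K *ᵥ v = 0 := by
    have : star (K *ᵥ v) ⬝ᵥ (R *ᵥ (K *ᵥ v)) = 0 := by
      rw [← e2.2, star_mulVec, ← dotProduct_mulVec, mulVec_mulVec, mulVec_mulVec, Matrix.mul_assoc]
    by_contra hne
    exact (hR.dotProduct_mulVec_pos hne).ne' this
  rw [add_mulVec, ← mulVec_mulVec, hKv, mulVec_zero, add_zero] at hv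
  exact hdet μ v hμ hv hQv

/-- A positive semidefinite solution of the Riccati equation is unique if `(A, Q)` is detectable. -/
theorem riccati_unique (hR : R.PosDef) (hQ : Q.PosSemidef) (hdet : IsDetectable A Q)
    {P₁ P₂ : Matrix ι ι ℂ} (h₁ : P₁.PosSemidef) (h₂ : P₂.PosSemidef)
    (e₁ : riccati A B Q R P₁ = 0) (e₂ : riccati A B Q R P₂ = 0) : P₁ = P₂ := by
  -- A stabilizing solution dominates every other solution, and by detectability every semidefinite
  -- solution is stabilizing.
  have key : ∀ {X Y : Matrix ι ι ℂ}, X.PosSemidef → Y.PosSemidef → riccati A B Q R X = 0 →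
      riccati A B Q R Y = 0 → (X - Y).PosSemidef := by
    intro X Y hX hY eX eY
    have hst : IsStable (A + B * cgain B R X) :=
      isStable_of_riccati hR hQ hdet hX (by rw [eX, neg_zero]; exact .zero)
    refine posSemidef_of_lyapunov hst (hX.isHermitian.sub hY.isHermitian) ?_
    have i1 := lyapunov_eq_riccati_add (A := A) (B := B) (Q := Q) hR hX.isHermitian (cgain B R X)
    have i2 := lyapunov_eq_riccati_add (A := A) (B := B) (Q := Q) hR hY.isHermitian (cgain B R X)
    rw [sub_self, Matrix.mul_zero, add_zero, eX] at i1
    rw [eY, zero_add] at i2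
    have : -((A + B * cgain B R X)ᴴ * (X - Y) + (X - Y) * (A + B * cgain B R X))
        = (cgain B R X - cgain B R Y)ᴴ * R * (cgain B R X - cgain B R Y) := by
      rw [← i2, ← sub_zero (_ + _ + (_ + _)), ← i1]
      noncomm_ring
    rw [this]
    exact hR.posSemidef.conjTranspose_mul_mul_same _
  have h := key h₁ h₂ e₁ e₂
  have h' := key h₂ h₁ e₂ e₁
  rw [← neg_sub] at h'
  exact sub_eq_zero.1 (eq_zero_of_posSemidef_of_neg h h')

section Compactness

open scoped Matrix.Norms.L2Operator MatrixOrder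

theorem isCompact_posSemidef_le (P₀ : Matrix ι ι ℂ) :
    IsCompact {P : Matrix ι ι ℂ | P.PosSemidef ∧ (P₀ - P).PosSemidef} := by
  have hcl : IsClosed {P : Matrix ι ι ℂ | P.PosSemidef} := by
    simp only [posSemidef_iff_dotProduct_mulVec, Set.ofPred_and, Set.ofPred_forall]
    refine (isClosed_eq (by fun_prop) continuous_id).inter (isClosed_iInter fun v => ?_)
    exact isClosed_le continuous_const (by fun_prop)
  have hcl' : IsClosed {P : Matrix ι ι ℂ | P.PosSemidef ∧ (P₀ - P).PosSemidef} :=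
    hcl.inter (hcl.preimage (f := fun P => P₀ - P) (by fun_prop))
  have : ProperSpace (Matrix ι ι ℂ) := FiniteDimensional.proper ℂ _
  refine Metric.isCompact_of_isClosed_isBounded hcl' ?_
  refine isBounded_iff_forall_norm_le.2 ⟨‖P₀‖, fun P hP => ?_⟩
  exact CStarAlgebra.norm_le_norm_of_nonneg_of_le (nonneg_iff_posSemidef.2 hP.1) hP.2

end Compactness

/-- The Riccati equation of a stabilizable and detectable system has a positive semidefinite
solution. -/
theorem exists_riccati (hR : R.PosDef) (hQ : Q.PosSemidef) (hdet : IsDetectable A Q)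
    (hstab : ∃ K : Matrix κ ι ℂ, IsStable (A + B * K)) :
    ∃ P : Matrix ι ι ℂ, P.PosSemidef ∧ riccati A B Q R P = 0 := by
  -- A Newton step: the cost matrix $X$ of a stabilizing gain has residual $-(K-K_X)^HR(K-K_X)\le0$,
  -- where $K_X$ is the gain of $X$.
  have step : ∀ K : Matrix κ ι ℂ, IsStable (A + B * K) → ∃ X : Matrix ι ι ℂ, X.PosSemidef ∧
      (A + B * K)ᴴ * X + X * (A + B * K) + (Q + Kᴴ * R * K) = 0 ∧
      (-riccati A B Q R X).PosSemidef := by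
    intro K hK
    obtain ⟨X, hX, hXe⟩ :=
      exists_lyapunov hK (hQ.add (hR.posSemidef.conjTranspose_mul_mul_same K))
    refine ⟨X, hX, hXe, ?_⟩
    rw [lyapunov_eq_riccati_add hR hX.isHermitian] at hXe
    rw [neg_eq_of_add_eq_zero_right hXe]
    exact hR.posSemidef.conjTranspose_mul_mul_same _
  obtain ⟨K₀, hK₀⟩ := hstab
  obtain ⟨P₀, hP₀, -, hric₀⟩ := step K₀ hK₀
  have hcl : IsClosed {P : Matrix ι ι ℂ | (-riccati A B Q R P).PosSemidef} := by
    have hc : Continuous fun P => riccati A B Q R P := by unfold riccati; fun_prop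
    simp only [posSemidef_iff_dotProduct_mulVec, Set.ofPred_and, Set.ofPred_forall]
    refine (isClosed_eq (by fun_prop) (by fun_prop)).inter (isClosed_iInter fun v => ?_)
    exact isClosed_le continuous_const (by fun_prop)
  obtain ⟨P, ⟨⟨hP, hPle⟩, hric⟩, hmin⟩ := ((isCompact_posSemidef_le P₀).inter_right hcl).exists_isMinOn
    ⟨P₀, ⟨hP₀, by rw [sub_self]; exact .zero⟩, hric₀⟩
    (f := fun P : Matrix ι ι ℂ => P.trace.re) (by fun_prop)
  refine ⟨P, hP, ?_⟩
  set K := cgain B R P with hK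
  have hst : IsStable (A + B * K) := isStable_of_riccati hR hQ hdet hP hric
  obtain ⟨X, hX, hXe, hXric⟩ := step K hst
  have hid := lyapunov_eq_riccati_add (A := A) (B := B) (Q := Q) hR hP.isHermitian K
  rw [← hK, sub_self, Matrix.mul_zero, add_zero] at hid
  -- The Newton step from $P$ decreases: the closed-loop Lyapunov operator sends $P-X$ to the
  -- residual of $P$, which is nonpositive. Minimality of the trace then forces $X=P$.
  have hPX : (P - X).PosSemidef := by
    refine posSemidef_of_lyapunov hst (hP.isHermitian.sub hX.isHermitian) ?_
    have : (A + B * K)ᴴ * (P - X) + (P - X) * (A + B * K) = riccati A B Q R P := by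
      rw [← hid, ← sub_zero (_ + _ + (_ + _)), ← hXe]
      noncomm_ring
    rwa [this]
  have htr : (P - X).trace = 0 := by
    have h1 : P.trace.re ≤ X.trace.re :=
      hmin ⟨⟨hX, by rw [← sub_add_sub_cancel P₀ P X]; exact hPle.add hPX⟩, hXric⟩
    have h2 := hPX.trace_nonneg
    rw [Complex.nonneg_iff] at h2
    refine Complex.ext ?_ h2.2.symm
    refine le_antisymm ?_ h2.1
    rw [trace_sub, Complex.sub_re, Complex.zero_re]
    linarith
  have hPX' : P = X := sub_eq_zero.1 ((PosSemidef.trace_eq_zero_iff hPX).1 htr)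
  rw [← hid, hPX', hXe]

end Riccati

end OutputRegulation

namespace OutputRegulation

open Matrix
open scoped ComplexOrder

/-! ### Passage between real and complex matrices. -/

section Complexification

variable {ι κ τ : Type*}

theorem toC_eq_map (A : Matrix ι κ ℝ) : toC A = A.map Complex.ofRealHom := rfl

theorem toC_injective : Function.Injective (toC : Matrix ι κ ℝ → Matrix ι κ ℂ) :=
  Matrix.map_injective Complex.ofReal_injective

@[simp] theorem toC_zero : toC (0 : Matrix ι κ ℝ) = 0 := by ext; simp [toC]

@[simp] theorem toC_one [DecidableEq ι] : toC (1 : Matrix ι ι ℝ) = 1 := by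
  ext i j; by_cases h : i = j <;> simp [toC, one_apply, h]

@[simp] theorem toC_add (A B : Matrix ι κ ℝ) : toC (A + B) = toC A + toC B := by ext; simp [toC]

@[simp] theorem toC_sub (A B : Matrix ι κ ℝ) : toC (A - B) = toC A - toC B := by ext; simp [toC]

@[simp] theorem toC_neg (A : Matrix ι κ ℝ) : toC (-A) = -toC A := by ext; simp [toC]

@[simp] theorem toC_mul [Fintype κ] (A : Matrix ι κ ℝ) (B : Matrix κ τ ℝ) :
    toC (A * B) = toC A * toC B := by
  simp only [toC_eq_map, Matrix.map_mul]

@[simp] theorem toC_transpose (A : Matrix ι κ ℝ) : toC Aᵀ = (toC A)ᴴ := by ext; simp [toC]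

theorem toC_inv [Fintype ι] [DecidableEq ι] {A : Matrix ι ι ℝ} (hA : IsUnit A) :
    toC A⁻¹ = (toC A)⁻¹ := by
  refine (inv_eq_right_inv ?_).symm
  rw [← toC_mul, mul_nonsing_inv _ ((isUnit_iff_isUnit_det _).1 hA), toC_one]

theorem toC_mulVec [Fintype κ] (A : Matrix ι κ ℝ) (v : κ → ℝ) :
    toC A *ᵥ (fun i => (v i : ℂ)) = fun i => ((A *ᵥ v) i : ℂ) := by
  ext i; simp [toC, mulVec, dotProduct]

theorem exists_toC_of_map_conj {P : Matrix ι κ ℂ} (h : P.map (starRingEnd ℂ) = P) :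
    ∃ P' : Matrix ι κ ℝ, P = toC P' := by
  refine ⟨P.map Complex.re, ?_⟩
  ext i j
  exact (Complex.conj_eq_iff_re.1 (congrFun (congrFun h i) j)).symm

@[simp] theorem toC_map_conj (A : Matrix ι κ ℝ) : (toC A).map (starRingEnd ℂ) = toC A := by
  ext; simp [toC]

variable [Fintype ι] [Fintype κ]

theorem posSemidef_toC {P : Matrix ι ι ℝ} : (toC P).PosSemidef ↔ P.PosSemidef := by
  classical
  constructor
  · intro h
    refine .of_dotProduct_mulVec_nonneg (toC_injective ?_) fun v => ?_
    · rw [conjTranspose_eq_transpose_of_trivial, toC_transpose, h.isHermitian.eq]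
    · have := h.dotProduct_mulVec_nonneg (fun i => (v i : ℂ))
      rw [toC_mulVec] at this
      simpa [dotProduct, ← Complex.ofReal_mul, ← Complex.ofReal_sum] using this
  · intro h
    obtain ⟨Y, rfl⟩ : ∃ Y : Matrix ι ι ℝ, P = Yᴴ * Y := by
      open scoped MatrixOrder in
      exact CStarAlgebra.nonneg_iff_eq_star_mul_self.1 (nonneg_iff_posSemidef.2 h)
    rw [conjTranspose_eq_transpose_of_trivial, toC_mul, toC_transpose]
    exact posSemidef_conjTranspose_mul_self _

theorem posDef_toC [DecidableEq ι] {P : Matrix ι ι ℝ} (h : P.PosDef) : (toC P).PosDef := by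
  refine ((posSemidef_toC.2 h.posSemidef).posDef_iff_isUnit).2 ?_
  have := (Complex.ofRealHom.mapMatrix (m := ι)).isUnit_map h.isUnit
  exact this

end Complexification

/-! ### Real Riccati and Lyapunov equations. -/

section RealRiccati

variable {ι κ τ : Type*} [Fintype ι] [Fintype κ] [DecidableEq κ]

theorem solvesRiccati_iff {A : Matrix ι ι ℝ} {B : Matrix ι κ ℝ} {Q P : Matrix ι ι ℝ}
    {R : Matrix κ κ ℝ} (hR : R.PosDef) :
    SolvesRiccati A B Q R P ↔ riccati (toC A) (toC B) (toC Q) (toC R) (toC P) = 0 := by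
  rw [SolvesRiccati, ← toC_injective.eq_iff, riccati]
  simp only [toC_sub, toC_add, toC_mul, toC_transpose, toC_inv hR.isUnit, toC_zero]

variable [DecidableEq ι]

theorem solvesRiccati_unique {A : Matrix ι ι ℝ} {B : Matrix ι κ ℝ} {Q P₁ P₂ : Matrix ι ι ℝ}
    {R : Matrix κ κ ℝ} (hR : R.PosDef) (hQ : Q.PosSemidef) (hdet : IsDetectable (toC A) (toC Q))
    (h₁ : P₁.PosSemidef) (h₂ : P₂.PosSemidef)
    (e₁ : SolvesRiccati A B Q R P₁) (e₂ : SolvesRiccati A B Q R P₂) : P₁ = P₂ :=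
  toC_injective <| riccati_unique (posDef_toC hR) (posSemidef_toC.2 hQ) hdet (posSemidef_toC.2 h₁)
    (posSemidef_toC.2 h₂) ((solvesRiccati_iff hR).1 e₁) ((solvesRiccati_iff hR).1 e₂)

/-- With real data the entrywise conjugate of a complex semidefinite solution is another one, so
uniqueness makes the solution real. -/
theorem exists_solvesRiccati {A : Matrix ι ι ℝ} {B : Matrix ι κ ℝ} {Q : Matrix ι ι ℝ}
    {R : Matrix κ κ ℝ} (hR : R.PosDef) (hQ : Q.PosSemidef) (hdet : IsDetectable (toC A) (toC Q))
    (hstab : ∃ K : Matrix κ ι ℂ, IsStable (toC A + toC B * K)) :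
    ∃ P : Matrix ι ι ℝ, P.PosSemidef ∧ SolvesRiccati A B Q R P := by
  obtain ⟨P, hP, hPe⟩ := exists_riccati (posDef_toC hR) (posSemidef_toC.2 hQ) hdet hstab
  have hconj : P.map (starRingEnd ℂ) = P := by
    refine riccati_unique (posDef_toC hR) (posSemidef_toC.2 hQ) hdet ?_ hP ?_ hPe
    · have : P.map (starRingEnd ℂ) = Pᵀ := by
        conv_rhs => rw [← hP.isHermitian.eq]
        rfl
      rw [this]; exact hP.transpose
    · have := congrArg (fun X : Matrix ι ι ℂ => X.map (starRingEnd ℂ)) hPe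
      simpa only [riccati, Matrix.map_sub _ (map_sub (starRingEnd ℂ)),
        Matrix.map_add _ (map_add (starRingEnd ℂ)), Matrix.map_mul, ← toC_transpose,
        ← toC_inv hR.isUnit, toC_map_conj, Matrix.map_zero _ (map_zero (starRingEnd ℂ))] using this
  obtain ⟨P', rfl⟩ := exists_toC_of_map_conj hconj
  exact ⟨P', posSemidef_toC.1 hP, (solvesRiccati_iff hR).2 hPe⟩

theorem exists_real_lyapunov {A Q : Matrix ι ι ℝ} (hA : IsHurwitz A) (hQ : Q.PosSemidef) :
    ∃ X : Matrix ι ι ℝ, X.PosSemidef ∧ Aᵀ * X + X * A + Q = 0 := by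
  obtain ⟨X, hX, hXe⟩ := exists_lyapunov (A := toC A) hA (posSemidef_toC.2 hQ)
  have hconj : X.map (starRingEnd ℂ) = X := by
    have := congrArg (fun X : Matrix ι ι ℂ => X.map (starRingEnd ℂ)) hXe
    simp only [Matrix.map_add _ (map_add (starRingEnd ℂ)), Matrix.map_mul, ← toC_transpose,
      toC_map_conj, Matrix.map_zero _ (map_zero (starRingEnd ℂ))] at this
    refine sub_eq_zero.1 (eq_zero_of_lyapunov (A := toC A) hA ?_)
    rw [Matrix.mul_sub, Matrix.sub_mul, sub_add_sub_comm, sub_eq_zero]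
    rw [toC_transpose] at this
    exact add_right_cancel (this.trans hXe.symm)
  obtain ⟨X', rfl⟩ := exists_toC_of_map_conj hconj
  refine ⟨X', posSemidef_toC.1 hX, toC_injective ?_⟩
  simpa using hXe

/-- Output injection gives detectability. -/
theorem isDetectable_of_isHurwitz [Fintype τ] [DecidableEq τ] {A : Matrix ι ι ℝ}
    {C : Matrix τ ι ℝ} {Q : Matrix τ τ ℝ} (hQ : Q.PosDef) {H : Matrix ι τ ℝ}
    (hH : IsHurwitz (A - H * C)) : IsDetectable (toC A) (toC (Cᵀ * Q * C)) := by
  intro μ v hμ hv hQv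
  have hC : toC C *ᵥ v = 0 := by
    by_contra hne
    refine ((posDef_toC hQ).dotProduct_mulVec_pos hne).ne' ?_
    have := congrArg (star v ⬝ᵥ ·) hQv
    simpa [star_mulVec, ← dotProduct_mulVec, mulVec_mulVec, Matrix.mul_assoc] using this
  refine IsStable.eq_zero_of_mulVec (A := toC (A - H * C)) hH hμ ?_
  rw [toC_sub, toC_mul, sub_mulVec, ← mulVec_mulVec, hC, mulVec_zero, sub_zero, hv]

end RealRiccati

end OutputRegulation

namespace OutputRegulation

open Matrix Polynomial
open scoped ComplexOrder Kronecker

/-! ### Full rank and trivial kernels. -/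

section Rank

variable {K ι κ : Type*} [Field K] [Fintype ι] [Fintype κ]

theorem eq_zero_of_vecMul_of_rank_eq {N : Matrix ι κ K} (hN : N.rank = Fintype.card ι)
    {v : ι → K} (hv : v ᵥ* N = 0) : v = 0 := by
  have h : LinearIndependent K N.row := by
    rw [linearIndependent_iff_card_eq_finrank_span, ← hN, rank_eq_finrank_span_row]
    rfl
  exact vecMul_injective_iff.2 h (by simpa using hv)

theorem eq_zero_of_mulVec_of_rank_eq {N : Matrix ι κ K} (hN : N.rank = Fintype.card κ)
    {v : κ → K} (hv : N *ᵥ v = 0) : v = 0 :=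
  eq_zero_of_vecMul_of_rank_eq (N := Nᵀ) (by rw [rank_transpose, hN]) (by rwa [vecMul_transpose])

theorem eq_zero_of_vecMul_toC_of_rank_eq {N : Matrix ι κ ℝ} (hN : N.rank = Fintype.card ι)
    {v : ι → ℂ} (hv : v ᵥ* toC N = 0) : v = 0 := by
  have h1 : (fun i => (v i).re) ᵥ* N = 0 := by
    ext j
    have := congrArg Complex.re (congrFun hv j)
    simpa [vecMul, dotProduct, toC] using this
  have h2 : (fun i => (v i).im) ᵥ* N = 0 := by
    ext j
    have := congrArg Complex.im (congrFun hv j)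
    simpa [vecMul, dotProduct, toC] using this
  ext i
  exact Complex.ext (congrFun (eq_zero_of_vecMul_of_rank_eq hN h1) i)
    (congrFun (eq_zero_of_vecMul_of_rank_eq hN h2) i)

end Rank

/-! ### Resolvent coefficients and the companion matrix. -/

section Resolvent

variable {n : ℕ} (F : Matrix (Fin n) (Fin n) ℝ)

theorem charmatrix_mul_apply (G : Matrix (Fin n) (Fin n) ℝ[X]) (i j : Fin n) :
    (F.charmatrix * G) i j = X * G i j - ∑ l, C (F i l) * G l j := by
  rw [charmatrix, Matrix.sub_mul, Matrix.sub_apply, scalar_apply, diagonal_mul, Matrix.mul_apply]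
  rfl

/-- Coefficient of $s^{k+1}$ in $(sI-F)\,\mathrm{adj}(sI-F)=\det(sI-F)I$. -/
theorem resolventCoeff_eq (k : ℕ) :
    resolventCoeff F k = F * resolventCoeff F (k + 1) + F.charpoly.coeff (k + 1) • 1 := by
  ext i j
  have h := congrArg (fun p : ℝ[X] => p.coeff (k + 1))
    (congrFun (congrFun (mul_adjugate F.charmatrix) i) j)
  simp only [charmatrix_mul_apply, coeff_sub, coeff_X_mul, finsetSum_coeff, coeff_C_mul] at h
  rw [sub_eq_iff_eq_add'] at h
  rw [Matrix.add_apply, Matrix.mul_apply]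
  refine h.trans (congrArg₂ _ rfl ?_)
  by_cases hij : i = j <;> simp [hij, charpoly]

theorem mul_resolventCoeff_zero :
    F * resolventCoeff F 0 = -(F.charpoly.coeff 0 • (1 : Matrix (Fin n) (Fin n) ℝ)) := by
  ext i j
  have h := congrArg (fun p : ℝ[X] => p.coeff 0)
    (congrFun (congrFun (mul_adjugate F.charmatrix) i) j)
  simp only [charmatrix_mul_apply, coeff_sub, coeff_X_mul_zero, finsetSum_coeff,
    coeff_C_mul] at h
  rw [zero_sub, neg_eq_iff_eq_neg] at h
  rw [Matrix.mul_apply]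
  refine h.trans ?_
  by_cases hij : i = j <;> simp [hij, charpoly]

theorem resolventCoeff_eq_zero {k : ℕ} (hk : n ≤ k) : resolventCoeff F k = 0 := by
  obtain ⟨N, hN⟩ : ∃ N, ∀ k, N ≤ k → resolventCoeff F k = 0 := by
    refine ⟨(Finset.univ.sup fun i => Finset.univ.sup fun j =>
      (F.charmatrix.adjugate i j).natDegree) + 1, fun k hk => ?_⟩
    ext i j
    refine coeff_eq_zero_of_natDegree_lt (lt_of_lt_of_le (Nat.lt_succ_of_le ?_) hk)
    exact (Finset.le_sup (f := fun j => (F.charmatrix.adjugate i j).natDegree)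
      (Finset.mem_univ j)).trans (Finset.le_sup (f := fun i => Finset.univ.sup fun j =>
        (F.charmatrix.adjugate i j).natDegree) (Finset.mem_univ i))
  -- Descending induction from a crude degree bound $N$: the recursion lowers it to $n$, as the
  -- characteristic polynomial has degree $n$.
  have step : ∀ m k, n ≤ k → N ≤ k + m → resolventCoeff F k = 0 := by
    intro m
    induction m with
    | zero => exact fun k _ h => hN k h
    | succ m ih =>
      intro k hk h
      rw [resolventCoeff_eq, ih (k + 1) (by omega) (by omega), Matrix.mul_zero, zero_add,
        coeff_eq_zero_of_natDegree_lt, zero_smul]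
      rw [charpoly_natDegree_eq_dim, Fintype.card_fin]
      omega
  exact step N k hk (by omega)

theorem resolventCoeff_pred {k : ℕ} (hk : k + 1 = n) : resolventCoeff F k = 1 := by
  have h : F.charpoly.coeff n = 1 := by
    have := F.charpoly_monic.coeff_natDegree
    rwa [charpoly_natDegree_eq_dim, Fintype.card_fin] at this
  rw [resolventCoeff_eq, resolventCoeff_eq_zero F hk.ge, hk, h, Matrix.mul_zero, zero_add, one_smul]

/-- Column $j$ of the companion matrix encodes $FD_j=D_{j-1}-\alpha_jD_{n-1}$, with $D_{n-1}=I$ and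
$D_{-1}=0$. -/
theorem sum_companionA_smul_resolventCoeff (j : Fin n) :
    ∑ l : Fin n, companionA F l j • resolventCoeff F l = F * resolventCoeff F j := by
  cases n with
  | zero => exact j.elim0
  | succ n =>
    rw [Fin.sum_univ_castSucc]
    have hl : companionA F (Fin.last n) j = -F.charpoly.coeff j := by simp [companionA]
    have hc : ∀ l : Fin n, companionA F l.castSucc j = if (j : ℕ) = l + 1 then 1 else 0 := by
      intro l
      simp [companionA, l.is_lt.ne]
    rw [hl, Fin.val_last, resolventCoeff_pred F rfl]
    simp only [hc, Fin.val_castSucc, ite_smul, one_smul, zero_smul]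
    refine Fin.cases ?_ (fun j => ?_) j
    · rw [Finset.sum_eq_zero fun l _ => by simp]
      simp [mul_resolventCoeff_zero]
    · rw [Finset.sum_eq_single j (fun l _ hl => if_neg fun h => hl (Fin.ext (by simpa using h.symm)))
        (by simp), Fin.val_succ, if_pos rfl, resolventCoeff_eq]
      simp

variable {F}

/-- The upper rows force $x=(1,\mu,\mu^2,\dots)^Tx_0$; the last row then says that $x_0$ times the
characteristic polynomial of $F$ at $\mu$ is zero. -/
theorem companionA_eigenvector_eq_zero (hF : IsHurwitz F) {μ : ℂ} (hμ : 0 ≤ μ.re)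
    {x : Fin n → ℂ} (hx : toC (companionA F) *ᵥ x = μ • x) : x = 0 := by
  cases n with
  | zero => exact Subsingleton.elim _ _
  | succ n =>
    have hrec : ∀ i : Fin n, x i.succ = μ * x i.castSucc := by
      intro i
      have := congrFun hx i.castSucc
      rw [mulVec, dotProduct, Finset.sum_eq_single i.succ] at this
      · simpa [toC, companionA, i.is_lt.ne] using this
      · intro j _ hj
        have : (j : ℕ) ≠ i + 1 := fun h => hj (Fin.ext (by simpa using h))
        simp [toC, companionA, i.is_lt.ne, this]
      · simp
    have hpow : ∀ i : Fin (n + 1), x i = μ ^ (i : ℕ) * x 0 := by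
      intro i
      induction i using Fin.induction with
      | zero => simp
      | succ i ih => rw [hrec, ih, Fin.val_succ, pow_succ, Fin.val_castSucc]; ring
    have hlast := congrFun hx (Fin.last n)
    have hx0 : x 0 = 0 := by
      by_contra hne
      refine absurd (hF μ ?_) (not_lt.2 hμ)
      rw [mem_spectrum_iff_isRoot_charpoly, toC_eq_map, charpoly_map, IsRoot, eval_map,
        eval₂_eq_sum_range, charpoly_natDegree_eq_dim, Fintype.card_fin, Finset.sum_range_succ]
      have hlead : F.charpoly.coeff (n + 1) = 1 := by
        have := F.charpoly_monic.coeff_natDegree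
        rwa [charpoly_natDegree_eq_dim, Fintype.card_fin] at this
      rw [hlead, map_one, one_mul, ← Fin.sum_univ_eq_sum_range
        (fun i => Complex.ofRealHom (F.charpoly.coeff i) * μ ^ i)]
      refine (mul_eq_zero.1 (?_ : _ * x 0 = 0)).resolve_right hne
      have h1 : (toC (companionA F) *ᵥ x) (Fin.last n)
          = -∑ i : Fin (n + 1), Complex.ofRealHom (F.charpoly.coeff i) * μ ^ (i : ℕ) * x 0 := by
        rw [mulVec, dotProduct, ← Finset.sum_neg_distrib]
        refine Finset.sum_congr rfl fun i _ => ?_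
        rw [hpow i]
        simp [toC, companionA, mul_assoc]
      rw [h1, Pi.smul_apply, hpow (Fin.last n), smul_eq_mul, Fin.val_last, ← mul_assoc, ← pow_succ',
        neg_eq_iff_add_eq_zero] at hlast
      rw [add_mul, Finset.sum_mul, hlast]
    ext i
    rw [hpow, hx0, mul_zero, Pi.zero_apply]

theorem isHurwitz_one_kronecker_companionA {τ : Type*} [Fintype τ] [DecidableEq τ]
    (hF : IsHurwitz F) :
    IsHurwitz ((1 : Matrix τ τ ℝ) ⊗ₖ companionA F) := by
  refine isStable_of_mulVec fun μ v hμ hv => ?_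
  have h : ∀ w : τ, (fun i => v (w, i)) = 0 := by
    intro w
    refine companionA_eigenvector_eq_zero hF hμ ?_
    ext i
    have := congrFun hv (w, i)
    rw [mulVec, dotProduct, Fintype.sum_prod_type, Finset.sum_eq_single w] at this
    · simpa [toC, mulVec, dotProduct] using this
    · intro w' _ hw
      simp [toC, hw.symm]
    · simp
  ext ⟨w, i⟩
  exact congrFun (h w) i

end Resolvent

section Blocks

variable {ι κ : Type*} [Fintype ι] [DecidableEq ι] [Fintype κ] [DecidableEq κ]

theorem isHurwitz_fromBlocks_neg_one {F : Matrix ι ι ℝ} (hF : IsHurwitz F) :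
    IsHurwitz (fromBlocks F 0 0 (-1 : Matrix κ κ ℝ)) := by
  refine isStable_of_mulVec fun μ v hμ hv => ?_
  have hb : toC (fromBlocks F 0 0 (-1 : Matrix κ κ ℝ)) = fromBlocks (toC F) 0 0 (-1) := by
    rw [← toC_one, ← toC_neg, ← toC_zero, ← toC_zero]
    exact fromBlocks_map _ _ _ _ _
  rw [hb, fromBlocks_mulVec] at hv
  have h1 : toC F *ᵥ (v ∘ Sum.inl) = μ • (v ∘ Sum.inl) := by
    ext i; simpa using congrFun hv (Sum.inl i)
  have h2 := IsStable.eq_zero_of_mulVec (A := toC F) hF hμ h1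
  ext i
  rcases i with i | i
  · exact congrFun h2 i
  · have := congrFun hv (Sum.inr i)
    simp only [Sum.elim_inr, zero_mulVec, zero_add, neg_mulVec, one_mulVec, Pi.neg_apply,
      Function.comp_apply, Pi.smul_apply, smul_eq_mul] at this
    have h3 : (μ + 1) * v (Sum.inr i) = 0 := by rw [add_mul, ← this]; ring
    refine (mul_eq_zero.1 h3).resolve_left fun h => ?_
    have := congrArg Complex.re h
    simp at this
    linarith

end Blocks

/-! ### The intertwining relations and output injection. -/

section Auxiliary

variable {n m p d : ℕ} (A : Matrix (Fin n) (Fin n) ℝ) (B : Matrix (Fin n) (Fin m) ℝ)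
  (C : Matrix (Fin p) (Fin n) ℝ) (L : Matrix (Fin n) (Fin p) ℝ)
  (β : Matrix (Fin d) (Fin d) ℝ) (σ : Fin d → ℝ)

theorem matM_mul_kronecker :
    matM A B C L * ((1 : Matrix (Fin m ⊕ Fin p) (Fin m ⊕ Fin p) ℝ) ⊗ₖ companionA (A - L * C))
      = (A - L * C) * matM A B C L := by
  ext i ⟨w, j⟩
  have hm := congrArg (fun Z => Z * fromCols B L)
    (sum_companionA_smul_resolventCoeff (A - L * C) j)
  simp only [Matrix.sum_mul, Matrix.smul_mul, Matrix.mul_assoc] at hm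
  have h := congrFun (congrFun hm i) w
  rw [Matrix.sum_apply] at h
  simp only [Matrix.smul_apply, smul_eq_mul] at h
  rw [Matrix.mul_apply, Fintype.sum_prod_type, Finset.sum_eq_single w]
  · rw [Matrix.mul_apply] at h
    rw [Matrix.mul_apply]
    simp only [matM, of_apply, kroneckerMap_apply, Matrix.one_apply_eq, one_mul]
    rw [← h]
    exact Finset.sum_congr rfl fun l _ => mul_comm _ _
  · intro w' _ hw
    refine Finset.sum_eq_zero fun l _ => ?_
    rw [kroneckerMap_apply, Matrix.one_apply_ne hw, zero_mul, mul_zero]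
  · exact fun h => absurd (Finset.mem_univ _) h

/-- The vector $b$ selects the last column $D_{n-1}f_w=f_w$ of each block of $M$. -/
theorem sum_matM_lastVec (i : Fin n) (w : Fin m ⊕ Fin p) :
    ∑ l, matM A B C L i (w, l) * lastVec n l = fromCols B L i w := by
  cases n with
  | zero => exact i.elim0
  | succ n =>
    rw [Finset.sum_eq_single (Fin.last n)]
    · simp [matM, lastVec, resolventCoeff_pred]
    · intro l _ hl
      have : (l : ℕ) ≠ n := fun h => hl (Fin.ext h)
      simp [lastVec, this]
    · simp

theorem matM_mul_Bzeta : matM A B C L * Bzeta n m p = B := by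
  ext i j
  rw [Matrix.mul_apply, Fintype.sum_prod_type, Finset.sum_eq_single (Sum.inl j)]
  · simpa [Bzeta] using sum_matM_lastVec A B C L i (Sum.inl j)
  · intro w _ hw
    simp [Bzeta, hw]
  · simp

theorem matM_mul_Ezeta : matM A B C L * Ezeta n m p = L := by
  ext i j
  rw [Matrix.mul_apply, Fintype.sum_prod_type, Finset.sum_eq_single (Sum.inr j)]
  · simpa [Ezeta] using sum_matM_lastVec A B C L i (Sum.inr j)
  · intro w _ hw
    simp [Ezeta, hw]
  · simp

/-- The term $E_\zeta CM$ restores exactly what output injection removed: $(A-LC)M+LCM=AM$. -/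
theorem matM_mul_Azeta : matM A B C L * Azeta A B C L = A * matM A B C L := by
  rw [Azeta, Matrix.mul_add, matM_mul_kronecker, Matrix.mul_assoc (Ezeta n m p),
    ← Matrix.mul_assoc (matM A B C L) (Ezeta n m p), matM_mul_Ezeta, Matrix.sub_mul,
    Matrix.mul_assoc L, sub_add_cancel]

theorem matW_mul_Arho : matW d A B C L * Arho A B C L β σ = augY A C β σ * matW d A B C L := by
  simp [matW, Arho, augY, fromBlocks_multiply, matM_mul_Azeta]

theorem matW_mul_Brho : matW d A B C L * Brho n m p d = augJ p d B := by
  simp [matW, Brho, augJ, fromBlocks_mul_fromRows, matM_mul_Bzeta]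

/-- Since $\bar C$ measures the whole internal model state, injection can cancel $G_2C$ and replace
$G_1$ by $-I$, whatever the spectrum of $\beta$. -/
theorem augY_sub_eq :
    augY A C β σ - fromBlocks L 0 (G2 p σ) (G1 p β + 1) * barC d C
      = fromBlocks (A - L * C) 0 0 (-1) := by
  rw [sub_eq_iff_eq_add]
  simp [augY, barC, fromBlocks_multiply, fromBlocks_add]

theorem Arho_sub_eq :
    Arho A B C L β σ
        - fromBlocks (Ezeta n m p) 0 (G2 p σ) (G1 p β + 1) * (barC d C * matW d A B C L)
      = fromBlocks ((1 : Matrix (Fin m ⊕ Fin p) (Fin m ⊕ Fin p) ℝ) ⊗ₖ companionA (A - L * C))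
          0 0 (-1) := by
  rw [sub_eq_iff_eq_add]
  simp [Arho, barC, matW, Azeta, fromBlocks_multiply, fromBlocks_add, Matrix.mul_assoc]

variable {A B C L β σ}

theorem isHurwitz_augY_sub (hL : IsHurwitz (A - L * C)) :
    IsHurwitz (augY A C β σ - fromBlocks L 0 (G2 p σ) (G1 p β + 1) * barC d C) := by
  rw [augY_sub_eq]; exact isHurwitz_fromBlocks_neg_one hL

theorem isHurwitz_Arho_sub (hL : IsHurwitz (A - L * C)) :
    IsHurwitz (Arho A B C L β σ
      - fromBlocks (Ezeta n m p) 0 (G2 p σ) (G1 p β + 1) * (barC d C * matW d A B C L)) := by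
  rw [Arho_sub_eq]; exact isHurwitz_fromBlocks_neg_one (isHurwitz_one_kronecker_companionA hL)

end Auxiliary

end OutputRegulation

namespace OutputRegulation

open Matrix Polynomial
open scoped ComplexOrder Kronecker

/-! ### Stabilizability of the augmented system and definiteness of its Riccati solution. -/

section InternalModel

variable {n m p q d : ℕ} {A : Matrix (Fin n) (Fin n) ℝ} {B : Matrix (Fin n) (Fin m) ℝ}
  {C : Matrix (Fin p) (Fin n) ℝ} {S : Matrix (Fin q) (Fin q) ℝ}
  {β : Matrix (Fin d) (Fin d) ℝ} {σ : Fin d → ℝ}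

theorem eq_zero_of_isControllable (hβσ : IsControllable β (replicateCol Unit σ)) {μ : ℂ}
    {z : Fin d → ℂ} (hz : z ᵥ* toC β = μ • z) (hzσ : z ⬝ᵥ (fun i => (σ i : ℂ)) = 0) : z = 0 := by
  refine eq_zero_of_vecMul_toC_of_rank_eq (hβσ.trans (Fintype.card_fin d).symm) ?_
  have hpow : ∀ k : ℕ, z ᵥ* toC (β ^ k) = μ ^ k • z := by
    intro k
    induction k with
    | zero => simp
    | succ k ih => rw [pow_succ, toC_mul, ← vecMul_vecMul, ih, smul_vecMul, hz, smul_smul, pow_succ]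
  ext ⟨k, u⟩
  have h1 : (z ᵥ* toC (β ^ (k : ℕ))) ⬝ᵥ (fun i => (σ i : ℂ)) = 0 := by
    rw [hpow, smul_dotProduct, hzσ, smul_zero]
  rw [← dotProduct_mulVec, toC_mulVec] at h1
  refine Eq.trans ?_ h1
  simp [vecMul, dotProduct, toC, Matrix.mul_apply, mulVec]

theorem mem_spectrum_of_charpoly_eq_minpoly (hβ : β.charpoly = minpoly ℝ S) {μ : ℂ}
    (hμ : μ ∈ spectrum ℂ (toC β)) : μ ∈ spectrum ℂ (toC S) := by
  rw [mem_spectrum_iff_isRoot_charpoly, toC_eq_map, charpoly_map] at hμ ⊢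
  rw [hβ] at hμ
  exact hμ.dvd (Polynomial.map_dvd _ (minpoly_dvd_charpoly S))

theorem vecMul_G1 {z : Fin p × Fin d → ℂ} {μ : ℂ} (h : z ᵥ* toC (G1 p β) = μ • z) (i : Fin p) :
    (fun k => z (i, k)) ᵥ* toC β = μ • fun k => z (i, k) := by
  ext k
  have := congrFun h (i, k)
  rw [vecMul, dotProduct, Fintype.sum_prod_type, Finset.sum_eq_single i] at this
  · simpa [toC, G1, vecMul, dotProduct] using this
  · intro j _ hj
    refine Finset.sum_eq_zero fun l _ => ?_
    rw [toC, Matrix.map_apply, G1, kroneckerMap_apply, Matrix.one_apply_ne hj]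
    simp
  · exact fun h => absurd (Finset.mem_univ _) h

theorem vecMul_G2 (z : Fin p × Fin d → ℂ) (i : Fin p) :
    (z ᵥ* toC (G2 p σ)) i = (fun k => z (i, k)) ⬝ᵥ (fun k => (σ k : ℂ)) := by
  rw [vecMul, dotProduct, Fintype.sum_prod_type, Finset.sum_eq_single i]
  · simp [toC, G2, dotProduct]
  · intro j _ hj
    simp [toC, G2, hj]
  · exact fun h => absurd (Finset.mem_univ _) h

/-- Let $(x,z)$ be a left eigenvector annihilating $J$. If $\mu$ is an eigenvalue of $S$, the row
$(x,zG_2)$ kills the full row rank matrix, so $x=0$, and the blocks of $z$ are left eigenvectors of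
$\beta$ orthogonal to $\sigma$. Otherwise $\mu$ is no eigenvalue of $\beta$, so $z=0$, and
stabilizability of $(A,B)$ gives $x=0$. -/
theorem augY_hautus (hAB : IsStabilizable A B)
    (hrank : ∀ μ ∈ spectrum ℂ (toC S),
      (Matrix.fromBlocks (toC A - μ • (1 : Matrix (Fin n) (Fin n) ℂ)) (toC B)
        (toC C) (0 : Matrix (Fin p) (Fin m) ℂ)).rank = n + p)
    (hβ : β.charpoly = minpoly ℝ S) (hβσ : IsControllable β (replicateCol Unit σ))
    (μ : ℂ) (w : Fin n ⊕ Fin p × Fin d → ℂ) (hμ : 0 ≤ μ.re)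
    (hw : w ᵥ* toC (augY A C β σ) = μ • w) (hwJ : w ᵥ* toC (augJ p d B) = 0) : w = 0 := by
  obtain ⟨x, z, rfl⟩ : ∃ x z, w = Sum.elim x z :=
    ⟨w ∘ Sum.inl, w ∘ Sum.inr, (Sum.elim_comp_inl_inr w).symm⟩
  have hY : toC (augY A C β σ)
      = fromBlocks (toC A) 0 (toC (G2 p σ) * toC C) (toC (G1 p β)) := by
    rw [← toC_mul, ← toC_zero]
    exact fromBlocks_map _ _ _ _ _
  have hJ : toC (augJ p d B) = fromRows (toC B) 0 := by
    ext (i | i) j <;> simp [toC, augJ]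
  rw [hY, vecMul_fromBlocks] at hw
  rw [hJ, vecMul_fromRows] at hwJ
  simp only [Sum.elim_comp_inl, Sum.elim_comp_inr, vecMul_zero, zero_add, add_zero] at hw hwJ
  have h1 : x ᵥ* toC A + (z ᵥ* toC (G2 p σ)) ᵥ* toC C = μ • x := by
    rw [vecMul_vecMul]
    ext i; simpa using congrFun hw (Sum.inl i)
  have h2 : z ᵥ* toC (G1 p β) = μ • z := by
    ext i; simpa using congrFun hw (Sum.inr i)
  have hxz : x = 0 ∧ z = 0 := by
    by_cases hS : μ ∈ spectrum ℂ (toC S)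
    · have h3 : Sum.elim x (z ᵥ* toC (G2 p σ)) = 0 := by
        refine eq_zero_of_vecMul_of_rank_eq (N := fromBlocks
          (toC A - μ • (1 : Matrix (Fin n) (Fin n) ℂ)) (toC B) (toC C)
          (0 : Matrix (Fin p) (Fin m) ℂ)) (by simpa using hrank μ hS) ?_
        rw [vecMul_fromBlocks]
        simp only [Sum.elim_comp_inl, Sum.elim_comp_inr, vecMul_zero, add_zero, hwJ, vecMul_sub,
          vecMul_smul, vecMul_one]
        rw [← h1, sub_add_eq_sub_sub, sub_self, zero_sub, neg_add_cancel]
        exact Sum.elim_zero_zero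
      have hx : x = 0 := funext fun i => congrFun h3 (Sum.inl i)
      refine ⟨hx, ?_⟩
      ext ⟨i, k⟩
      refine congrFun (eq_zero_of_isControllable hβσ (vecMul_G1 h2 i) ?_) k
      rw [← vecMul_G2]
      exact congrFun h3 (Sum.inr i)
    · have hz : z = 0 := by
        ext ⟨i, k⟩
        by_contra hne
        refine hS (mem_spectrum_of_charpoly_eq_minpoly hβ (mem_spectrum_iff_exists_vecMul.2
          ⟨fun k => z (i, k), fun h => hne (congrFun h k), vecMul_G1 h2 i⟩))
      refine ⟨?_, hz⟩
      obtain ⟨K, hK⟩ := hAB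
      rw [hz, zero_vecMul, zero_vecMul, add_zero] at h1
      refine IsStable.eq_zero_of_vecMul (A := toC (A + B * K)) hK hμ ?_
      rw [toC_add, toC_mul, vecMul_add, ← vecMul_vecMul, hwJ, zero_vecMul, add_zero, h1]
  rw [hxz.1, hxz.2]
  exact Sum.elim_zero_zero

/-- Testing the equation on $v\in\ker P$ gives $\bar Cv=0$ and then $PYv=0$. Hence $v=(x,0)$ with
$CA^kx=0$ for all $k$. -/
theorem posDef_of_solvesRiccati_augY (hAC : IsObservable A C)
    {R : Matrix (Fin m) (Fin m) ℝ} {Qbar : Matrix (Fin p ⊕ Fin p × Fin d) (Fin p ⊕ Fin p × Fin d) ℝ}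
    (hQ : Qbar.PosDef) {P : Matrix (Fin n ⊕ Fin p × Fin d) (Fin n ⊕ Fin p × Fin d) ℝ}
    (hP : P.PosSemidef)
    (hPe : SolvesRiccati (augY A C β σ) (augJ p d B) ((barC d C)ᵀ * Qbar * barC d C) R P) :
    P.PosDef := by
  have hPt : Pᵀ = P := hP.isHermitian.eq
  have hker : ∀ v, P *ᵥ v = 0 → barC d C *ᵥ v = 0 ∧ P *ᵥ (augY A C β σ *ᵥ v) = 0 := by
    intro v hv
    have h0 := congrArg (fun Z => Z *ᵥ v) hPe
    simp only [sub_mulVec, add_mulVec, ← mulVec_mulVec, hv, mulVec_zero, zero_mulVec, zero_add,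
      sub_zero] at h0
    have h1 : barC d C *ᵥ v = 0 := by
      by_contra hne
      refine (hQ.dotProduct_mulVec_pos hne).ne' ?_
      have h2 := congrArg (fun y => v ⬝ᵥ y) h0
      simp only [dotProduct_add, dotProduct_zero] at h2
      rw [dotProduct_mulVec v P, ← mulVec_transpose, hPt, hv, zero_dotProduct, zero_add,
        dotProduct_mulVec, vecMul_transpose] at h2
      simpa using h2
    refine ⟨h1, ?_⟩
    rwa [h1, mulVec_zero, mulVec_zero, add_zero] at h0
  have hobs : ∀ (k : ℕ) (x : Fin n → ℝ), P *ᵥ Sum.elim x 0 = 0 → (C * A ^ k) *ᵥ x = 0 := by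
    intro k
    induction k with
    | zero =>
      intro x hx
      have := (hker _ hx).1
      rw [barC, fromBlocks_mulVec] at this
      ext i
      simpa using congrFun this (Sum.inl i)
    | succ k ih =>
      intro x hx
      have hCx : C *ᵥ x = 0 := by
        have := (hker _ hx).1
        rw [barC, fromBlocks_mulVec] at this
        ext i
        simpa using congrFun this (Sum.inl i)
      have h2 := (hker _ hx).2
      rw [augY, fromBlocks_mulVec] at h2
      simp only [Sum.elim_comp_inl, Sum.elim_comp_inr, mulVec_zero, add_zero, ← mulVec_mulVec, hCx]
        at h2
      rw [pow_succ, ← Matrix.mul_assoc, ← mulVec_mulVec]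
      exact ih _ h2
  rw [hP.posDef_iff_det_ne_zero]
  intro hdet
  obtain ⟨v, hv0, hv⟩ := exists_mulVec_eq_zero_iff.2 hdet
  obtain ⟨x, z, rfl⟩ : ∃ x z, v = Sum.elim x z :=
    ⟨v ∘ Sum.inl, v ∘ Sum.inr, (Sum.elim_comp_inl_inr v).symm⟩
  have hz : z = 0 := by
    have := (hker _ hv).1
    rw [barC, fromBlocks_mulVec] at this
    ext i
    simpa using congrFun this (Sum.inr i)
  subst hz
  refine hv0 ?_
  rw [eq_zero_of_mulVec_of_rank_eq (v := x) (hAC.trans (Fintype.card_fin n).symm) ?_]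
  · exact Sum.elim_zero_zero
  · ext ⟨k, i⟩
    exact congrFun (hobs k x hv) i

end InternalModel

end OutputRegulation

namespace OutputRegulation

open Matrix MeasureTheory Filter Topology
open scoped ENNReal

/-! ### Quadratic form estimates, completion of squares and dissipation. -/

section QuadraticForms

variable {ι κ τ : Type*} [Fintype ι] [Fintype κ] [Fintype τ]

theorem dotProduct_mulVec_le_sum_abs_mul (Z : Matrix ι ι ℝ) (z : ι → ℝ) :
    z ⬝ᵥ (Z *ᵥ z) ≤ (∑ i, ∑ j, |Z i j|) * (z ⬝ᵥ z) := by
  have hz : ∀ i, z i * z i ≤ z ⬝ᵥ z := fun i =>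
    Finset.single_le_sum (f := fun i => z i * z i) (fun i _ => mul_self_nonneg _)
      (Finset.mem_univ i)
  have hsum : z ⬝ᵥ (Z *ᵥ z) = ∑ i, ∑ j, z i * (Z i j * z j) := by
    simp only [dotProduct, mulVec, Finset.mul_sum]
  rw [hsum, Finset.sum_mul]
  simp only [Finset.sum_mul]
  refine Finset.sum_le_sum fun i _ => Finset.sum_le_sum fun j _ => ?_
  calc z i * (Z i j * z j) ≤ |z i * (Z i j * z j)| := le_abs_self _
    _ = |Z i j| * (|z i| * |z j|) := by rw [abs_mul, abs_mul]; ring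
    _ ≤ |Z i j| * (z ⬝ᵥ z) := by
      refine mul_le_mul_of_nonneg_left ?_ (abs_nonneg _)
      nlinarith [hz i, hz j, abs_mul_abs_self (z i), abs_mul_abs_self (z j),
        sq_nonneg (|z i| - |z j|)]

theorem exists_dotProduct_mulVec_le [DecidableEq ι] {D : Matrix ι ι ℝ} (hD : D.PosDef)
    (S : Matrix ι ι ℝ) : ∃ c : ℝ, 0 ≤ c ∧ ∀ y, y ⬝ᵥ (S *ᵥ y) ≤ c * (y ⬝ᵥ (D *ᵥ y)) := by
  obtain ⟨Y, rfl⟩ : ∃ Y : Matrix ι ι ℝ, D = Yᴴ * Y := by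
    open scoped MatrixOrder in
    exact CStarAlgebra.nonneg_iff_eq_star_mul_self.1 (nonneg_iff_posSemidef.2 hD.posSemidef)
  rw [conjTranspose_eq_transpose_of_trivial] at hD ⊢
  have hY : IsUnit Y.det := by
    have := (isUnit_iff_isUnit_det _).1 hD.isUnit
    rw [det_mul] at this
    exact isUnit_of_mul_isUnit_right this
  have hid : Y⁻¹ * Y = 1 := nonsing_inv_mul _ hY
  refine ⟨∑ i, ∑ j, |((Y⁻¹)ᵀ * S * Y⁻¹) i j|, by positivity, fun y => ?_⟩
  have h := dotProduct_mulVec_le_sum_abs_mul ((Y⁻¹)ᵀ * S * Y⁻¹) (Y *ᵥ y)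
  have e1 : (Y *ᵥ y) ⬝ᵥ (((Y⁻¹)ᵀ * S * Y⁻¹) *ᵥ (Y *ᵥ y)) = y ⬝ᵥ (S *ᵥ y) := by
    rw [mulVec_mulVec, Matrix.mul_assoc, hid, Matrix.mul_one, ← vecMul_transpose,
      ← dotProduct_mulVec, mulVec_mulVec, ← Matrix.mul_assoc, ← transpose_mul, hid, transpose_one,
      Matrix.one_mul]
  have e2 : (Y *ᵥ y) ⬝ᵥ (Y *ᵥ y) = y ⬝ᵥ ((Yᵀ * Y) *ᵥ y) := by
    rw [← mulVec_mulVec, dotProduct_mulVec y, vecMul_transpose]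
  rwa [e1, e2] at h

/-- The weight $1/4$ lets `exists_dissipation` absorb two cross terms and still keep half of
$|x|^2$. -/
theorem two_mul_dotProduct_le (x v : ι → ℝ) :
    2 * (x ⬝ᵥ v) ≤ (1 / 4) * (x ⬝ᵥ x) + 4 * (v ⬝ᵥ v) := by
  simp only [dotProduct, Finset.mul_sum, ← Finset.sum_add_distrib]
  exact Finset.sum_le_sum fun i _ => by nlinarith [sq_nonneg (x i / 2 - 2 * v i)]

theorem exists_two_mul_dotProduct_le [DecidableEq κ] {D : Matrix κ κ ℝ} (hD : D.PosDef)
    (G : Matrix ι κ ℝ) : ∃ c : ℝ, 0 ≤ c ∧ ∀ (x : ι → ℝ) (y : κ → ℝ),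
      2 * (x ⬝ᵥ (G *ᵥ y)) ≤ (1 / 4) * (x ⬝ᵥ x) + c * (y ⬝ᵥ (D *ᵥ y)) := by
  obtain ⟨c, hc, h⟩ := exists_dotProduct_mulVec_le hD (Gᵀ * G)
  refine ⟨4 * c, by positivity, fun x y => (two_mul_dotProduct_le x _).trans ?_⟩
  have := h y
  rw [← mulVec_mulVec, dotProduct_mulVec, vecMul_transpose] at this
  linarith

/-- Along a trajectory the last term is the derivative of $x^TPx$, so the excess $|u-Kx|_R^2$ is the
running cost plus that derivative. -/
theorem completion_of_squares [DecidableEq κ] {A : Matrix ι ι ℝ} {B : Matrix ι κ ℝ} {Q P : Matrix ι ι ℝ}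
    {R : Matrix κ κ ℝ} (hR : R.PosDef) (hP : P.PosSemidef) (hPe : SolvesRiccati A B Q R P)
    (x : ι → ℝ) (u : κ → ℝ) :
    (u - gain B R P *ᵥ x) ⬝ᵥ (R *ᵥ (u - gain B R P *ᵥ x))
      = x ⬝ᵥ (Q *ᵥ x) + u ⬝ᵥ (R *ᵥ u) + 2 * (x ⬝ᵥ (P *ᵥ (A *ᵥ x + B *ᵥ u))) := by
  have hPt : Pᵀ = P := hP.isHermitian.eq
  have hRt : Rᵀ = R := hR.isHermitian.eq
  have hu : IsUnit R.det := (isUnit_iff_isUnit_det _).1 hR.isUnit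
  set K := gain B R P with hK
  have hRK : R *ᵥ (K *ᵥ x) = -(Bᵀ *ᵥ (P *ᵥ x)) := by
    rw [hK, gain, mulVec_mulVec, Matrix.mul_neg, Matrix.mul_assoc,
      mul_nonsing_inv_cancel_left _ _ hu, neg_mulVec, mulVec_mulVec]
  have hsymP : ∀ y z : ι → ℝ, y ⬝ᵥ (P *ᵥ z) = z ⬝ᵥ (P *ᵥ y) := by
    intro y z
    rw [dotProduct_mulVec, ← mulVec_transpose, hPt, dotProduct_comm]
  have hsymR : ∀ y z : κ → ℝ, y ⬝ᵥ (R *ᵥ z) = z ⬝ᵥ (R *ᵥ y) := by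
    intro y z
    rw [dotProduct_mulVec, ← mulVec_transpose, hRt, dotProduct_comm]
  have hBt : ∀ w : κ → ℝ, w ⬝ᵥ (Bᵀ *ᵥ (P *ᵥ x)) = x ⬝ᵥ (P *ᵥ (B *ᵥ w)) := by
    intro w
    rw [dotProduct_mulVec, vecMul_transpose, hsymP]
  have hric : 2 * (x ⬝ᵥ (P *ᵥ (A *ᵥ x))) + x ⬝ᵥ (Q *ᵥ x) + x ⬝ᵥ (P *ᵥ (B *ᵥ (K *ᵥ x))) = 0 := by
    have h := congrArg (fun Z => x ⬝ᵥ (Z *ᵥ x)) hPe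
    simp only [sub_mulVec, add_mulVec, dotProduct_add, dotProduct_sub, zero_mulVec,
      dotProduct_zero, ← mulVec_mulVec] at h
    rw [dotProduct_mulVec x Aᵀ, vecMul_transpose, hsymP (A *ᵥ x)] at h
    have : K *ᵥ x = -(R⁻¹ *ᵥ (Bᵀ *ᵥ (P *ᵥ x))) := by
      rw [hK, gain, neg_mulVec, mulVec_mulVec, mulVec_mulVec]
    rw [this, mulVec_neg, mulVec_neg, dotProduct_neg]
    linarith
  rw [mulVec_sub, dotProduct_sub, sub_dotProduct, sub_dotProduct, hsymR (K *ᵥ x) u, hRK,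
    dotProduct_neg, dotProduct_neg, hBt, hBt, mulVec_add, dotProduct_add]
  linarith

variable [DecidableEq ι] [DecidableEq κ] [DecidableEq τ]

/-- A dissipation inequality for a system with output injection. -/
theorem exists_dissipation {A : Matrix ι ι ℝ} {B : Matrix ι κ ℝ} {C : Matrix τ ι ℝ}
    {Q : Matrix τ τ ℝ} (hQ : Q.PosDef) {R : Matrix κ κ ℝ} (hR : R.PosDef) {H : Matrix ι τ ℝ}
    (hH : IsHurwitz (A - H * C)) :
    ∃ X : Matrix ι ι ℝ, X.PosSemidef ∧ ∃ c : ℝ, 0 ≤ c ∧ ∀ (x : ι → ℝ) (u : κ → ℝ),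
      (1 / 2) * (x ⬝ᵥ x) + 2 * (x ⬝ᵥ (X *ᵥ (A *ᵥ x + B *ᵥ u)))
        ≤ c * (x ⬝ᵥ ((Cᵀ * Q * C) *ᵥ x) + u ⬝ᵥ (R *ᵥ u)) := by
  -- With $(A-HC)^TX+X(A-HC)=-I$, the form $x^TXx$ decreases at rate $|x|^2$ up to cross terms in
  -- $Cx$ and $u$, which the running cost controls.
  obtain ⟨X, hX, hXe⟩ := exists_real_lyapunov hH PosSemidef.one
  have hXt : Xᵀ = X := hX.isHermitian.eq
  obtain ⟨c₁, hc₁, h₁⟩ := exists_two_mul_dotProduct_le hQ (X * H)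
  obtain ⟨c₂, hc₂, h₂⟩ := exists_two_mul_dotProduct_le hR (X * B)
  refine ⟨X, hX, c₁ + c₂, by positivity, fun x u => ?_⟩
  have e1 : x ⬝ᵥ ((Cᵀ * Q * C) *ᵥ x) = (C *ᵥ x) ⬝ᵥ (Q *ᵥ (C *ᵥ x)) := by
    rw [← mulVec_mulVec, ← mulVec_mulVec, dotProduct_mulVec, vecMul_transpose]
  have n1 := hQ.posSemidef.dotProduct_mulVec_nonneg (C *ᵥ x)
  have n2 := hR.posSemidef.dotProduct_mulVec_nonneg u
  rw [star_trivial] at n1 n2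
  have e2 : 2 * (x ⬝ᵥ (X *ᵥ ((A - H * C) *ᵥ x))) = -(x ⬝ᵥ x) := by
    have := congrArg (fun Z => x ⬝ᵥ (Z *ᵥ x)) hXe
    simp only [add_mulVec, dotProduct_add, one_mulVec, zero_mulVec, dotProduct_zero,
      ← mulVec_mulVec] at this
    rw [dotProduct_mulVec x (A - H * C)ᵀ, vecMul_transpose, dotProduct_comm ((A - H * C) *ᵥ x),
      ← vecMul_transpose X, hXt, ← dotProduct_mulVec] at this
    linarith
  have e3 : A *ᵥ x + B *ᵥ u = (A - H * C) *ᵥ x + (H *ᵥ (C *ᵥ x) + B *ᵥ u) := by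
    rw [sub_mulVec, ← mulVec_mulVec]; abel
  have i1 := h₁ x (C *ᵥ x)
  have i2 := h₂ x u
  rw [← mulVec_mulVec] at i1 i2
  rw [e1, e3, mulVec_add, mulVec_add, dotProduct_add, dotProduct_add, mul_add, mul_add, e2]
  nlinarith [mul_nonneg hc₁ n2, mul_nonneg hc₂ n1]

end QuadraticForms

/-! ### Calculus along Carathéodory trajectories. -/

section Trajectories

variable {ι κ : Type*} [Fintype ι] [Fintype κ]

/-- For a merely integrable input the state is only absolutely continuous, so the product rule holds
almost everywhere and is used in integrated form. -/
theorem integral_deriv_mul_eq_sub_of_primitive {f h φ ψ : ℝ → ℝ} {T f₀ h₀ : ℝ} (hT : 0 ≤ T)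
    (hφ : IntervalIntegrable φ volume 0 T) (hψ : IntervalIntegrable ψ volume 0 T)
    (hf : ∀ t ∈ Set.Icc 0 T, f t = f₀ + ∫ s in (0 : ℝ)..t, φ s)
    (hh : ∀ t ∈ Set.Icc 0 T, h t = h₀ + ∫ s in (0 : ℝ)..t, ψ s) :
    ∫ s in (0 : ℝ)..T, (φ s * h s + f s * ψ s) = f T * h T - f₀ * h₀ := by
  set F : ℝ → ℝ := fun t => f₀ + ∫ s in (0 : ℝ)..t, φ s with hF
  set G : ℝ → ℝ := fun t => h₀ + ∫ s in (0 : ℝ)..t, ψ s with hG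
  have hconst : ∀ c : ℝ, AbsolutelyContinuousOnInterval (fun _ : ℝ => c) 0 T := fun c =>
    (LipschitzWith.const c).lipschitzOnWith.absolutelyContinuousOnInterval
  have hFac : AbsolutelyContinuousOnInterval F 0 T :=
    (hconst f₀).add (hφ.absolutelyContinuousOnInterval_intervalIntegral (c := 0) (by simp))
  have hGac : AbsolutelyContinuousOnInterval G 0 T :=
    (hconst h₀).add (hψ.absolutelyContinuousOnInterval_intervalIntegral (c := 0) (by simp))
  have key := hFac.integral_deriv_mul_eq_sub hGac
  have e0 : F 0 = f₀ ∧ G 0 = h₀ := by simp [hF, hG]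
  have e1 : F T = f T ∧ G T = h T := ⟨(hf T ⟨hT, le_rfl⟩).symm, (hh T ⟨hT, le_rfl⟩).symm⟩
  rw [e0.1, e0.2, e1.1, e1.2] at key
  rw [← key]
  refine intervalIntegral.integral_congr_ae ?_
  filter_upwards [hφ.ae_hasDerivAt_integral, hψ.ae_hasDerivAt_integral] with s h1 h2 hs
  have hs' := Set.uIoc_subset_uIcc hs
  have d1 := ((h1 hs' 0 (by simp)).const_add f₀).deriv
  have d2 := ((h2 hs' 0 (by simp)).const_add h₀).deriv
  rw [Set.uIcc_of_le hT] at hs'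
  rw [hf s hs', hh s hs']
  change _ = deriv (fun x => f₀ + ∫ t in (0 : ℝ)..x, φ t) s * G s
    + F s * deriv (fun x => h₀ + ∫ t in (0 : ℝ)..x, ψ t) s
  rw [d1, d2]

variable {A : Matrix ι ι ℝ} {B : Matrix ι κ ℝ} {x₀ : ι → ℝ} {x : ℝ → ι → ℝ} {u : ℝ → κ → ℝ}

theorem intervalIntegrable_fun_sum {α : Type*} {s : Finset α} {f : α → ℝ → ℝ} {a b : ℝ}
    (h : ∀ i ∈ s, IntervalIntegrable (f i) volume a b) :
    IntervalIntegrable (fun t => ∑ i ∈ s, f i t) volume a b := by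
  have := IntervalIntegrable.sum s h
  rwa [Finset.sum_fn] at this

theorem intervalIntegrable_mulVec {τ : Type*} [Fintype τ] (G : Matrix τ κ ℝ) {a b : ℝ}
    (hu : IntervalIntegrable u volume a b) :
    IntervalIntegrable (fun s => G *ᵥ u s) volume a b := by
  have h := fun s : Set ℝ => fun hs : IntegrableOn u s volume =>
    (LinearMap.toContinuousLinearMap (Matrix.mulVecLin G)).integrable_comp hs
  exact ⟨h _ hu.1, h _ hu.2⟩

namespace IsTrajectory

theorem continuousOn_uIcc (h : IsTrajectory A B x₀ x u) {T : ℝ} (hT : 0 ≤ T) :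
    ContinuousOn x (Set.uIcc 0 T) :=
  h.continuousOn.mono (by rw [Set.uIcc_of_le hT]; exact Set.Icc_subset_Ici_self)

theorem intervalIntegrable_deriv (h : IsTrajectory A B x₀ x u) {T : ℝ} (hT : 0 ≤ T) :
    IntervalIntegrable (fun s => A *ᵥ x s + B *ᵥ u s) volume 0 T :=
  (intervalIntegrable_mulVec A (h.continuousOn_uIcc hT).intervalIntegrable).add
    (intervalIntegrable_mulVec B (h.input_integrable T hT))

theorem intervalIntegrable_deriv_apply (h : IsTrajectory A B x₀ x u) {T : ℝ} (hT : 0 ≤ T) (i : ι) :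
    IntervalIntegrable (fun s => (A *ᵥ x s + B *ᵥ u s) i) volume 0 T := by
  have h1 := h.intervalIntegrable_deriv hT
  exact ⟨(ContinuousLinearMap.proj (R := ℝ) (φ := fun _ : ι => ℝ) i).integrable_comp h1.1,
    (ContinuousLinearMap.proj (R := ℝ) (φ := fun _ : ι => ℝ) i).integrable_comp h1.2⟩

theorem apply_eq (h : IsTrajectory A B x₀ x u) {t : ℝ} (ht : 0 ≤ t) (i : ι) :
    x t i = x₀ i + ∫ s in (0 : ℝ)..t, (A *ᵥ x s + B *ᵥ u s) i := by
  have h1 := congrFun (h.integral_eq t ht) i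
  rw [h1, Pi.add_apply]
  congr 1
  exact ((ContinuousLinearMap.proj (R := ℝ) (φ := fun _ : ι => ℝ) i).intervalIntegral_comp_comm
    (h.intervalIntegrable_deriv ht)).symm

/-- The energy balance of a quadratic form along a trajectory. -/
theorem energy (h : IsTrajectory A B x₀ x u) {X : Matrix ι ι ℝ} (hX : Xᵀ = X) {T : ℝ}
    (hT : 0 ≤ T) :
    IntervalIntegrable (fun s => 2 * (x s ⬝ᵥ (X *ᵥ (A *ᵥ x s + B *ᵥ u s)))) volume 0 T ∧
    ∫ s in (0 : ℝ)..T, 2 * (x s ⬝ᵥ (X *ᵥ (A *ᵥ x s + B *ᵥ u s)))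
      = x T ⬝ᵥ (X *ᵥ x T) - x₀ ⬝ᵥ (X *ᵥ x₀) := by
  set g : ℝ → ι → ℝ := fun s => A *ᵥ x s + B *ᵥ u s with hg
  have hxc : ∀ i, ContinuousOn (fun s => x s i) (Set.uIcc 0 T) := fun i =>
    (continuous_apply i).comp_continuousOn (h.continuousOn_uIcc hT)
  have hgi : ∀ i, IntervalIntegrable (fun s => g s i) volume 0 T :=
    h.intervalIntegrable_deriv_apply hT
  have hterm : ∀ i j, IntervalIntegrable
      (fun s => X i j * (g s i * x s j + x s i * g s j)) volume 0 T := fun i j =>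
    (((hgi i).mul_continuousOn (hxc j)).add ((hgi j).continuousOn_mul (hxc i))).const_mul _
  have hfun : (fun s => 2 * (x s ⬝ᵥ (X *ᵥ g s)))
      = fun s => ∑ i, ∑ j, X i j * (g s i * x s j + x s i * g s j) := by
    ext s
    have hsym : g s ⬝ᵥ (X *ᵥ x s) = x s ⬝ᵥ (X *ᵥ g s) := by
      rw [dotProduct_mulVec, ← mulVec_transpose, hX, dotProduct_comm]
    rw [two_mul]
    nth_rewrite 1 [← hsym]
    simp only [dotProduct, mulVec, Finset.mul_sum, ← Finset.sum_add_distrib]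
    refine Finset.sum_congr rfl fun i _ => Finset.sum_congr rfl fun j _ => by ring
  rw [hfun]
  refine ⟨intervalIntegrable_fun_sum fun i _ => intervalIntegrable_fun_sum fun j _ => hterm i j, ?_⟩
  rw [intervalIntegral.integral_finsetSum
    (fun i _ => intervalIntegrable_fun_sum fun j _ => hterm i j)]
  have : ∀ v : ι → ℝ, v ⬝ᵥ (X *ᵥ v) = ∑ i, ∑ j, X i j * (v i * v j) := by
    intro v
    simp only [dotProduct, mulVec, Finset.mul_sum]
    refine Finset.sum_congr rfl fun i _ => Finset.sum_congr rfl fun j _ => by ring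
  rw [this, this, ← Finset.sum_sub_distrib]
  refine Finset.sum_congr rfl fun i _ => ?_
  rw [intervalIntegral.integral_finsetSum (fun j _ => hterm i j), ← Finset.sum_sub_distrib]
  refine Finset.sum_congr rfl fun j _ => ?_
  rw [intervalIntegral.integral_const_mul, integral_deriv_mul_eq_sub_of_primitive hT (hgi i) (hgi j)
    (fun t ht => h.apply_eq ht.1 i) (fun t ht => h.apply_eq ht.1 j), mul_sub]

end IsTrajectory

end Trajectories

end OutputRegulation

namespace OutputRegulation

open Matrix MeasureTheory Filter Topology
open scoped ENNReal

/-! ### Optimality of the Riccati feedback. -/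

section Optimality

variable {ι κ τ : Type*} [Fintype ι] [Fintype κ] [Fintype τ]

theorem Ioi_eq_iUnion_Ioc : Set.Ioi (0 : ℝ) = ⋃ k : ℕ, Set.Ioc 0 (k : ℝ) := by
  ext t
  simp only [Set.mem_Ioi, Set.mem_iUnion, Set.mem_Ioc]
  exact ⟨fun h => (exists_nat_ge t).imp fun _ hk => ⟨h, hk⟩, fun ⟨_, h⟩ => h.1⟩

theorem running_cost_nonneg {Q : Matrix ι ι ℝ} {R : Matrix κ κ ℝ} (hQ : Q.PosSemidef)
    (hR : R.PosSemidef) (x : ι → ℝ) (u : κ → ℝ) :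
    0 ≤ x ⬝ᵥ (Q *ᵥ x) + u ⬝ᵥ (R *ᵥ u) := by
  simpa using add_nonneg (hQ.dotProduct_mulVec_nonneg x) (hR.dotProduct_mulVec_nonneg u)

variable {A : Matrix ι ι ℝ} {B : Matrix ι κ ℝ} {Q P : Matrix ι ι ℝ} {R : Matrix κ κ ℝ}
  {x₀ : ι → ℝ} {x : ℝ → ι → ℝ} {u : ℝ → κ → ℝ}

theorem IsTrajectory.aestronglyMeasurable (h : IsTrajectory A B x₀ x u) (Q : Matrix ι ι ℝ)
    (R : Matrix κ κ ℝ) :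
    AEStronglyMeasurable (fun t => x t ⬝ᵥ (Q *ᵥ x t) + u t ⬝ᵥ (R *ᵥ u t))
      (volume.restrict (Set.Ioi 0)) := by
  have hx : AEStronglyMeasurable x (volume.restrict (Set.Ioi 0)) :=
    (h.continuousOn.mono Set.Ioi_subset_Ici_self).aestronglyMeasurable measurableSet_Ioi
  have hu : AEStronglyMeasurable u (volume.restrict (Set.Ioi 0)) := by
    rw [Ioi_eq_iUnion_Ioc]
    exact (aestronglyMeasurable_iUnion_iff).2 fun k =>
      (h.input_integrable k (Nat.cast_nonneg k)).1.aestronglyMeasurable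
  have hc : Continuous fun y : (ι → ℝ) × (κ → ℝ) => y.1 ⬝ᵥ (Q *ᵥ y.1) + y.2 ⬝ᵥ (R *ᵥ y.2) := by
    fun_prop
  exact hc.comp_aestronglyMeasurable (hx.prodMk hu)

theorem IsTrajectory.integrableOn_of_cost (h : IsTrajectory A B x₀ x u) (hQ : Q.PosSemidef)
    (hR : R.PosSemidef) (hc : cost Q R x u < ∞) :
    IntegrableOn (fun t => x t ⬝ᵥ (Q *ᵥ x t) + u t ⬝ᵥ (R *ᵥ u t)) (Set.Ioi 0) := by
  refine ⟨h.aestronglyMeasurable Q R, ?_⟩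
  rw [hasFiniteIntegral_iff_ofReal (Eventually.of_forall fun _ => running_cost_nonneg hQ hR _ _)]
  exact hc

theorem cost_eq_ofReal_integral (hQ : Q.PosSemidef) (hR : R.PosSemidef)
    (hi : IntegrableOn (fun t => x t ⬝ᵥ (Q *ᵥ x t) + u t ⬝ᵥ (R *ᵥ u t)) (Set.Ioi 0)) :
    cost Q R x u
      = ENNReal.ofReal (∫ t in Set.Ioi 0, (x t ⬝ᵥ (Q *ᵥ x t) + u t ⬝ᵥ (R *ᵥ u t))) :=
  (ofReal_integral_eq_lintegral_ofReal hi
    (Eventually.of_forall fun _ => running_cost_nonneg hQ hR _ _)).symm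

theorem intervalIntegrable_of_integrableOn_Ioi {f : ℝ → ℝ} (hf : IntegrableOn f (Set.Ioi 0))
    {T : ℝ} (hT : 0 ≤ T) : IntervalIntegrable f volume 0 T :=
  (intervalIntegrable_iff_integrableOn_Ioc_of_le hT).2 (hf.mono_set Set.Ioc_subset_Ioi_self)

theorem intervalIntegral_le_integral_Ioi {f : ℝ → ℝ} (hf : IntegrableOn f (Set.Ioi 0))
    (h0 : ∀ t, 0 ≤ f t) {T : ℝ} (hT : 0 ≤ T) :
    ∫ t in (0 : ℝ)..T, f t ≤ ∫ t in Set.Ioi 0, f t := by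
  rw [intervalIntegral.integral_of_le hT]
  exact setIntegral_mono_set hf (Eventually.of_forall h0) Set.Ioc_subset_Ioi_self.eventuallyLE

theorem IsTrajectory.integral_excess [DecidableEq κ] (h : IsTrajectory A B x₀ x u)
    (hR : R.PosDef) (hP : P.PosSemidef) (hPe : SolvesRiccati A B Q R P) {T : ℝ} (hT : 0 ≤ T)
    (hi : IntervalIntegrable (fun t => x t ⬝ᵥ (Q *ᵥ x t) + u t ⬝ᵥ (R *ᵥ u t)) volume 0 T) :
    IntervalIntegrable (fun t => (u t - gain B R P *ᵥ x t) ⬝ᵥ (R *ᵥ (u t - gain B R P *ᵥ x t)))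
      volume 0 T ∧
    ∫ t in (0 : ℝ)..T, (u t - gain B R P *ᵥ x t) ⬝ᵥ (R *ᵥ (u t - gain B R P *ᵥ x t))
      = (∫ t in (0 : ℝ)..T, (x t ⬝ᵥ (Q *ᵥ x t) + u t ⬝ᵥ (R *ᵥ u t)))
        + (x T ⬝ᵥ (P *ᵥ x T) - x₀ ⬝ᵥ (P *ᵥ x₀)) := by
  obtain ⟨hV, hVe⟩ := h.energy (X := P) hP.isHermitian.eq hT
  simp only [completion_of_squares hR hP hPe]
  exact ⟨hi.add hV, by rw [intervalIntegral.integral_add hi hV, hVe]⟩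

section Exponential

open scoped Matrix.Norms.Operator

/-- The linear feedback `u = K x` has a trajectory from every initial state. -/
theorem exists_isTrajectory_feedback [DecidableEq ι] (A : Matrix ι ι ℝ) (B : Matrix ι κ ℝ) (K : Matrix κ ι ℝ)
    (x₀ : ι → ℝ) : ∃ x : ℝ → ι → ℝ, IsTrajectory A B x₀ x (fun t => K *ᵥ x t) := by
  set F := A + B * K with hF
  set x : ℝ → ι → ℝ := fun t => NormedSpace.exp (t • F) *ᵥ x₀ with hx
  have hder : ∀ t, HasDerivAt x (A *ᵥ x t + B *ᵥ (K *ᵥ x t)) t := by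
    intro t
    have h1 := hasDerivAt_exp_smul_const' (𝕂 := ℝ) F t
    let ev : Matrix ι ι ℝ →L[ℝ] (ι → ℝ) := LinearMap.toContinuousLinearMap
      { toFun := fun Z => Z *ᵥ x₀
        map_add' := fun Y Z => add_mulVec Y Z x₀
        map_smul' := fun c Z => smul_mulVec c Z x₀ }
    have h2 := ev.hasFDerivAt.comp_hasDerivAt t h1
    have h3 : ev (F * NormedSpace.exp (t • F)) = A *ᵥ x t + B *ᵥ (K *ᵥ x t) := by
      change (F * NormedSpace.exp (t • F)) *ᵥ x₀ = _
      rw [← mulVec_mulVec, hF, add_mulVec, ← mulVec_mulVec]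
    rw [← h3]
    exact h2
  have hcont : Continuous x := continuous_iff_continuousAt.2 fun t => (hder t).continuousAt
  have hx0 : x 0 = x₀ := by simp [hx]
  refine ⟨x, ⟨fun t _ => Continuous.intervalIntegrable (by fun_prop) _ _, hcont.continuousOn,
    fun t _ => ?_⟩⟩
  rw [intervalIntegral.integral_eq_sub_of_hasDerivAt (fun s _ => hder s)
    (Continuous.intervalIntegrable (by fun_prop) _ _), hx0]
  abel

end Exponential

variable [DecidableEq ι] [DecidableEq κ] [DecidableEq τ]

/-- Along a trajectory of finite cost of a detectable system every quadratic form in the state gets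
arbitrarily small at arbitrarily late times. -/
theorem IsTrajectory.exists_small {C : Matrix τ ι ℝ} {Qbar : Matrix τ τ ℝ} {H : Matrix ι τ ℝ}
    (h : IsTrajectory A B x₀ x u) (hQ : Qbar.PosDef) (hR : R.PosDef)
    (hH : IsHurwitz (A - H * C))
    (hi : IntegrableOn (fun t => x t ⬝ᵥ ((Cᵀ * Qbar * C) *ᵥ x t) + u t ⬝ᵥ (R *ᵥ u t)) (Set.Ioi 0))
    (P : Matrix ι ι ℝ) {ε : ℝ} (hε : 0 < ε) {N : ℝ} (hN : 0 ≤ N) :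
    ∃ T, N ≤ T ∧ x T ⬝ᵥ (P *ᵥ x T) < ε := by
  obtain ⟨X, hX, c, hc, hdis⟩ := exists_dissipation (B := B) hQ hR hH
  obtain ⟨c', hc', hP⟩ := exists_dotProduct_mulVec_le (PosDef.one (n := ι) (R := ℝ)) P
  have hQ' : (Cᵀ * Qbar * C).PosSemidef := by
    simpa using hQ.posSemidef.conjTranspose_mul_mul_same C
  -- Otherwise $|x|^2$ stays above a positive constant after time $N$, so its integral grows
  -- linearly, while the dissipation inequality bounds it by the finite cost.
  by_contra! hlarge
  set I := ∫ t in Set.Ioi 0, (x t ⬝ᵥ ((Cᵀ * Qbar * C) *ᵥ x t) + u t ⬝ᵥ (R *ᵥ u t)) with hI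
  have hsq : ∀ y : ι → ℝ, 0 ≤ y ⬝ᵥ y := fun y => Finset.sum_nonneg fun i _ => mul_self_nonneg _
  have hc1 : 0 < c' + 1 := by positivity
  have hlow : ∀ t, N ≤ t → ε / (c' + 1) ≤ x t ⬝ᵥ x t := by
    intro t ht
    rw [div_le_iff₀ hc1]
    have h1 := hlarge t ht
    have h2 := hP (x t)
    rw [one_mulVec] at h2
    nlinarith [hsq (x t)]
  have hbound : ∀ T, N ≤ T →
      (1 / 2) * ((T - N) * (ε / (c' + 1))) ≤ c * I + x₀ ⬝ᵥ (X *ᵥ x₀) := by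
    intro T hT
    have hT0 : 0 ≤ T := hN.trans hT
    obtain ⟨hV, hVe⟩ := h.energy (X := X) hX.isHermitian.eq hT0
    have hxx : IntervalIntegrable (fun s => x s ⬝ᵥ x s) volume 0 T := by
      refine ContinuousOn.intervalIntegrable ?_
      have hcont : Continuous fun y : ι → ℝ => y ⬝ᵥ y := by fun_prop
      exact hcont.comp_continuousOn (h.continuousOn_uIcc hT0)
    have h1 := intervalIntegral.integral_mono_on hT0 ((hxx.const_mul (1 / 2)).add hV)
      ((intervalIntegrable_of_integrableOn_Ioi hi hT0).const_mul c) fun t _ => hdis (x t) (u t)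
    rw [intervalIntegral.integral_add (hxx.const_mul _) hV, hVe, intervalIntegral.integral_const_mul,
      intervalIntegral.integral_const_mul] at h1
    have h2 := mul_le_mul_of_nonneg_left (intervalIntegral_le_integral_Ioi hi
      (fun t => running_cost_nonneg hQ' hR.posSemidef _ _) hT0) hc
    have h3 := hX.dotProduct_mulVec_nonneg (x T)
    rw [star_trivial] at h3
    have hsplit : Set.uIcc N T ⊆ Set.uIcc 0 T := by
      rw [Set.uIcc_of_le hT, Set.uIcc_of_le hT0]
      exact Set.Icc_subset_Icc_left hN
    have h4 : (T - N) * (ε / (c' + 1)) ≤ ∫ t in (0 : ℝ)..T, x t ⬝ᵥ x t := by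
      have h5 : ∫ t in N..T, ε / (c' + 1) ≤ ∫ t in N..T, x t ⬝ᵥ x t :=
        intervalIntegral.integral_mono_on hT intervalIntegrable_const (hxx.mono_set hsplit)
          fun t ht => hlow t ht.1
      rw [intervalIntegral.integral_const, smul_eq_mul] at h5
      refine h5.trans ?_
      exact intervalIntegral.integral_mono_interval hN hT le_rfl
        (Eventually.of_forall fun t => hsq (x t)) hxx
    linarith
  have hd : 0 < ε / (c' + 1) := by positivity
  set M := c * I + x₀ ⬝ᵥ (X *ᵥ x₀) with hM
  -- At this time the left side equals $|M|+1$, which exceeds the bound $M$.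
  have h1 := hbound (N + (2 * (|M| + 1)) / (ε / (c' + 1))) (by
    have : 0 ≤ (2 * (|M| + 1)) / (ε / (c' + 1)) := by positivity
    linarith)
  rw [add_sub_cancel_left, div_mul_cancel₀ _ hd.ne'] at h1
  linarith [le_abs_self M]

/-- The excess integral up to $T$ grows with $T$, so it may be bounded at a later time where
$x^TPx<\varepsilon$. Taking $T=0$ gives the lower bound on the cost; if that is attained, the excess
vanishes almost everywhere. -/
theorem IsTrajectory.le_integral {C : Matrix τ ι ℝ} {Qbar : Matrix τ τ ℝ} {H : Matrix ι τ ℝ}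
    (h : IsTrajectory A B x₀ x u) (hQ : Qbar.PosDef) (hR : R.PosDef)
    (hH : IsHurwitz (A - H * C)) (hP : P.PosSemidef)
    (hPe : SolvesRiccati A B (Cᵀ * Qbar * C) R P)
    (hi : IntegrableOn (fun t => x t ⬝ᵥ ((Cᵀ * Qbar * C) *ᵥ x t) + u t ⬝ᵥ (R *ᵥ u t))
      (Set.Ioi 0)) :
    x₀ ⬝ᵥ (P *ᵥ x₀)
        ≤ ∫ t in Set.Ioi 0, (x t ⬝ᵥ ((Cᵀ * Qbar * C) *ᵥ x t) + u t ⬝ᵥ (R *ᵥ u t)) ∧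
      ((∫ t in Set.Ioi 0, (x t ⬝ᵥ ((Cᵀ * Qbar * C) *ᵥ x t) + u t ⬝ᵥ (R *ᵥ u t)))
          = x₀ ⬝ᵥ (P *ᵥ x₀) →
        ∀ᵐ t ∂(volume.restrict (Set.Ioi (0 : ℝ))), u t = gain B R P *ᵥ x t) := by
  set q : ℝ → ℝ := fun t => x t ⬝ᵥ ((Cᵀ * Qbar * C) *ᵥ x t) + u t ⬝ᵥ (R *ᵥ u t) with hq
  set e : ℝ → ℝ := fun t =>
    (u t - gain B R P *ᵥ x t) ⬝ᵥ (R *ᵥ (u t - gain B R P *ᵥ x t)) with he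
  have hQ' : (Cᵀ * Qbar * C).PosSemidef := by
    simpa using hQ.posSemidef.conjTranspose_mul_mul_same C
  have hq0 : ∀ t, 0 ≤ q t := fun t => running_cost_nonneg hQ' hR.posSemidef _ _
  have he0 : ∀ t, 0 ≤ e t := fun t =>
    hR.posSemidef.dotProduct_mulVec_nonneg (u t - gain B R P *ᵥ x t)
  have hex : ∀ T, 0 ≤ T → IntervalIntegrable e volume 0 T ∧ ∫ t in (0 : ℝ)..T, e t
      = (∫ t in (0 : ℝ)..T, q t) + (x T ⬝ᵥ (P *ᵥ x T) - x₀ ⬝ᵥ (P *ᵥ x₀)) := fun T hT =>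
    h.integral_excess hR hP hPe hT (intervalIntegrable_of_integrableOn_Ioi hi hT)
  have hle : ∀ T, 0 ≤ T → ∫ t in (0 : ℝ)..T, e t ≤ (∫ t in Set.Ioi 0, q t) - x₀ ⬝ᵥ (P *ᵥ x₀) := by
    intro T hT
    refine le_of_forall_pos_le_add fun ε hε => ?_
    obtain ⟨T', hTT', hsmall⟩ := h.exists_small hQ hR hH hi P hε hT
    have hT' := hT.trans hTT'
    have h1 : ∫ t in (0 : ℝ)..T, e t ≤ ∫ t in (0 : ℝ)..T', e t :=
      intervalIntegral.integral_mono_interval le_rfl hT hTT' (Eventually.of_forall he0)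
        (hex T' hT').1
    have h2 := (hex T' hT').2
    have h3 := intervalIntegral_le_integral_Ioi hi hq0 hT'
    linarith
  refine ⟨by simpa using hle 0 le_rfl, fun heq => ?_⟩
  have hae : ∀ᵐ t ∂(volume.restrict (Set.Ioi (0 : ℝ))), e t = 0 := by
    rw [Ioi_eq_iUnion_Ioc, ae_restrict_iUnion_iff]
    intro k
    have hk : (0 : ℝ) ≤ k := Nat.cast_nonneg k
    have h1 := hle k hk
    rw [heq, sub_self] at h1
    have h2 : ∫ t in (0 : ℝ)..k, e t = 0 :=
      le_antisymm h1 (intervalIntegral.integral_nonneg hk fun t _ => he0 t)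
    exact (intervalIntegral.integral_eq_zero_iff_of_le_of_nonneg_ae hk
      (Eventually.of_forall he0) (hex k hk).1).1 h2
  filter_upwards [hae] with t ht
  by_contra hne
  have := hR.dotProduct_mulVec_pos (sub_ne_zero.2 hne)
  rw [star_trivial] at this
  exact this.ne' ht

/-- The feedback given by a positive semidefinite solution of the Riccati equation of a detectable
system solves the linear quadratic regulator problem. -/
theorem isLQRSolution_gain {C : Matrix τ ι ℝ} {Qbar : Matrix τ τ ℝ} {H : Matrix ι τ ℝ}
    (hQ : Qbar.PosDef) (hR : R.PosDef) (hH : IsHurwitz (A - H * C)) (hP : P.PosSemidef)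
    (hPe : SolvesRiccati A B (Cᵀ * Qbar * C) R P) :
    IsLQRSolution A B (Cᵀ * Qbar * C) R (gain B R P) := by
  intro x₀
  obtain ⟨x, h⟩ := exists_isTrajectory_feedback A B (gain B R P) x₀
  have hQ' : (Cᵀ * Qbar * C).PosSemidef := by
    simpa using hQ.posSemidef.conjTranspose_mul_mul_same C
  set q : ℝ → ℝ := fun t => x t ⬝ᵥ ((Cᵀ * Qbar * C) *ᵥ x t)
    + (gain B R P *ᵥ x t) ⬝ᵥ (R *ᵥ (gain B R P *ᵥ x t)) with hq
  have hq0 : ∀ t, 0 ≤ q t := fun t => running_cost_nonneg hQ' hR.posSemidef _ _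
  have hqi : ∀ T, 0 ≤ T → IntervalIntegrable q volume 0 T := by
    intro T hT
    have hc : Continuous fun y : ι → ℝ => y ⬝ᵥ ((Cᵀ * Qbar * C) *ᵥ y)
      + (gain B R P *ᵥ y) ⬝ᵥ (R *ᵥ (gain B R P *ᵥ y)) := by fun_prop
    exact (hc.comp_continuousOn (h.continuousOn_uIcc hT)).intervalIntegrable
  -- The feedback has zero excess, so its cost up to $T$ is $x_0^TPx_0-x(T)^TPx(T)$.
  have hqle : ∀ T, 0 ≤ T → ∫ t in (0 : ℝ)..T, q t ≤ x₀ ⬝ᵥ (P *ᵥ x₀) := by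
    intro T hT
    have h1 := (h.integral_excess hR hP hPe hT (hqi T hT)).2
    simp only [sub_self, zero_dotProduct, intervalIntegral.integral_zero] at h1
    have h2 := hP.dotProduct_mulVec_nonneg (x T)
    rw [star_trivial] at h2
    linarith
  have hi : IntegrableOn q (Set.Ioi 0) := by
    refine integrableOn_Ioi_of_intervalIntegral_norm_bounded (x₀ ⬝ᵥ (P *ᵥ x₀)) 0
      (b := fun k : ℕ => (k : ℝ)) (l := atTop)
      (fun k => (intervalIntegrable_iff_integrableOn_Ioc_of_le (Nat.cast_nonneg k)).1
        (hqi k (Nat.cast_nonneg k))) tendsto_natCast_atTop_atTop (Eventually.of_forall fun k => ?_)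
    simp only [Real.norm_eq_abs, abs_of_nonneg (hq0 _)]
    exact hqle k (Nat.cast_nonneg k)
  have hval : ∫ t in Set.Ioi 0, q t = x₀ ⬝ᵥ (P *ᵥ x₀) := by
    refine le_antisymm ?_ (h.le_integral hQ hR hH hP hPe hi).1
    exact le_of_tendsto (intervalIntegral_tendsto_integral_Ioi 0 hi tendsto_natCast_atTop_atTop)
      (Eventually.of_forall fun k : ℕ => hqle k (Nat.cast_nonneg k))
  have hcost : cost (Cᵀ * Qbar * C) R x (fun t => gain B R P *ᵥ x t)
      = ENNReal.ofReal (x₀ ⬝ᵥ (P *ᵥ x₀)) := by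
    rw [cost_eq_ofReal_integral hQ' hR.posSemidef hi]
    exact congrArg _ hval
  refine ⟨x, h, by rw [hcost]; exact ENNReal.ofReal_lt_top, fun x' u' h' => ?_⟩
  rw [hcost]
  rcases eq_or_ne (cost (Cᵀ * Qbar * C) R x' u') ∞ with htop | htop
  · rw [htop]
    exact ⟨le_top, fun h => absurd h.symm ENNReal.ofReal_ne_top⟩
  · have hi' := h'.integrableOn_of_cost hQ' hR.posSemidef (lt_top_iff_ne_top.2 htop)
    have hopt := h'.le_integral hQ hR hH hP hPe hi'
    rw [cost_eq_ofReal_integral hQ' hR.posSemidef hi']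
    refine ⟨ENNReal.ofReal_le_ofReal hopt.1, fun heq => hopt.2 ?_⟩
    have hP0 := hP.dotProduct_mulVec_nonneg x₀
    rw [star_trivial] at hP0
    exact (ENNReal.ofReal_eq_ofReal_iff (hP0.trans hopt.1) hP0).1 heq

end Optimality

end OutputRegulation

theorem theorem4 {n m p q d : ℕ}
    (A : Matrix (Fin n) (Fin n) ℝ) (B : Matrix (Fin n) (Fin m) ℝ)
    (C : Matrix (Fin p) (Fin n) ℝ) (S : Matrix (Fin q) (Fin q) ℝ)
    (hAB : IsStabilizable A B)
    (hAC : IsObservable A C)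
    (hS : ∀ μ ∈ spectrum ℂ (toC S), 0 ≤ μ.re)
    (hrank : ∀ μ ∈ spectrum ℂ (toC S),
      (Matrix.fromBlocks (toC A - μ • (1 : Matrix (Fin n) (Fin n) ℂ)) (toC B)
        (toC C) (0 : Matrix (Fin p) (Fin m) ℂ)).rank = n + p)
    (β : Matrix (Fin d) (Fin d) ℝ) (σ : Fin d → ℝ)
    (hβ : β.charpoly = minpoly ℝ S)
    (hβσ : IsControllable β (Matrix.replicateCol Unit σ))
    (L : Matrix (Fin n) (Fin p) ℝ) (hL : IsHurwitz (A - L * C))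
    (R : Matrix (Fin m) (Fin m) ℝ) (hR : R.PosDef)
    (Qbar : Matrix (Fin p ⊕ Fin p × Fin d) (Fin p ⊕ Fin p × Fin d) ℝ) (hQ : Qbar.PosDef)
    (Qξ : Matrix (Fin n ⊕ Fin p × Fin d) (Fin n ⊕ Fin p × Fin d) ℝ)
    (hQξ : Qξ = (barC d C)ᵀ * Qbar * barC d C)
    (W : Matrix (Fin n ⊕ Fin p × Fin d) ((Fin m ⊕ Fin p) × Fin n ⊕ Fin p × Fin d) ℝ)
    (hW : W = matW d A B C L)
    (Qρ : Matrix ((Fin m ⊕ Fin p) × Fin n ⊕ Fin p × Fin d)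
      ((Fin m ⊕ Fin p) × Fin n ⊕ Fin p × Fin d) ℝ)
    (hQρ : Qρ = Wᵀ * Qξ * W) :
    ∃ Pξ : Matrix (Fin n ⊕ Fin p × Fin d) (Fin n ⊕ Fin p × Fin d) ℝ,
      (∀ P, P.PosDef ∧ SolvesRiccati (augY A C β σ) (augJ p d B) Qξ R P ↔ P = Pξ) ∧
      (∀ P, P.PosSemidef ∧ SolvesRiccati (Arho A B C L β σ) (Brho n m p d) Qρ R P ↔
        P = Wᵀ * Pξ * W) ∧
      gain (Brho n m p d) R (Wᵀ * Pξ * W) = gain (augJ p d B) R Pξ * W ∧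
      IsLQRSolution (Arho A B C L β σ) (Brho n m p d) Qρ R
        (gain (Brho n m p d) R (Wᵀ * Pξ * W)) := by
  have hQP : ((barC d C)ᵀ * Qbar * barC d C).PosSemidef := by
    simpa using hQ.posSemidef.conjTranspose_mul_mul_same (barC d C)
  have hQρ' : Qρ = (barC d C * W)ᵀ * Qbar * (barC d C * W) := by
    rw [hQρ, hQξ, Matrix.transpose_mul]
    simp only [Matrix.mul_assoc]
  have hYW : W * Arho A B C L β σ = augY A C β σ * W := by rw [hW, matW_mul_Arho]
  have hJW : W * Brho n m p d = augJ p d B := by rw [hW, matW_mul_Brho]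
  have hdetξ : IsDetectable (toC (augY A C β σ)) (toC ((barC d C)ᵀ * Qbar * barC d C)) :=
    isDetectable_of_isHurwitz hQ (isHurwitz_augY_sub hL)
  have hHρ := isHurwitz_Arho_sub (B := B) (β := β) (σ := σ) hL
  rw [← hW] at hHρ
  have hdetρ := isDetectable_of_isHurwitz hQ hHρ
  obtain ⟨Pξ, hPξ, hPξe⟩ := exists_solvesRiccati hR hQP hdetξ
    (exists_isStable_add_mul (augY_hautus hAB hrank hβ hβσ))
  have hQρP : ((barC d C * W)ᵀ * Qbar * (barC d C * W)).PosSemidef := by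
    simpa using hQ.posSemidef.conjTranspose_mul_mul_same (barC d C * W)
  have hPρ : (Wᵀ * Pξ * W).PosSemidef := by
    simpa using hPξ.conjTranspose_mul_mul_same W
  have hJWt : (Brho n m p d)ᵀ * Wᵀ = (augJ p d B)ᵀ := by rw [← Matrix.transpose_mul, hJW]
  have hYWt : (Arho A B C L β σ)ᵀ * Wᵀ = Wᵀ * (augY A C β σ)ᵀ := by
    rw [← Matrix.transpose_mul, hYW, Matrix.transpose_mul]
  -- Existence for $(A_\rho,B_\rho)$ is inherited through $W$; stabilizability of that pair is never
  -- checked.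
  have hPρe : SolvesRiccati (Arho A B C L β σ) (Brho n m p d)
      ((barC d C * W)ᵀ * Qbar * (barC d C * W)) R (Wᵀ * Pξ * W) := by
    have h := congrArg (fun Z => Wᵀ * Z * W) hPξe
    simp only [Matrix.mul_zero, Matrix.zero_mul] at h
    rw [SolvesRiccati, ← h]
    simp only [Matrix.mul_sub, Matrix.mul_add, Matrix.sub_mul, Matrix.add_mul]
    congr 1
    · congr 1
      · congr 1
        · rw [← Matrix.mul_assoc, ← Matrix.mul_assoc, hYWt]
          simp only [Matrix.mul_assoc]
        · rw [Matrix.mul_assoc, hYW]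
          simp only [Matrix.mul_assoc]
      · rw [Matrix.transpose_mul]
        simp only [Matrix.mul_assoc]
    · rw [← hJWt, ← hJW]
      simp only [Matrix.mul_assoc]
  subst hQξ
  subst hQρ'
  refine ⟨Pξ, fun P => ⟨fun h => ?_, ?_⟩, fun P => ⟨fun h => ?_, ?_⟩, ?_, ?_⟩
  · exact solvesRiccati_unique hR hQP hdetξ h.1.posSemidef hPξ h.2 hPξe
  · rintro rfl
    exact ⟨posDef_of_solvesRiccati_augY hAC hQ hPξ hPξe, hPξe⟩
  · exact solvesRiccati_unique hR hQρP hdetρ h.1 hPρ h.2 hPρe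
  · rintro rfl
    exact ⟨hPρ, hPρe⟩
  · rw [gain, gain, ← hJWt]
    simp only [Matrix.neg_mul, Matrix.mul_assoc]
  · exact isLQRSolution_gain hQ hR hHρ hPρ hPρe
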